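/- Let $d$ be a positive integer and let $\gamma_1,\dots,\gamma_d$ be independent standard complex Gaussian random variables on a probability space $(\Omega,\mathbb P)$, i.e. each $\gamma_i$ has law $\frac1\pi e^{-|z|^2}\,d\mathrm{Re}z\,d\mathrm{Im}z$ on $\mathbb C$. Let $\mathrm{Tr}$ be the non-normalized trace on $M_n(\mathbb C)$, let $\|x\|_1=\mathrm{Tr}((x^*x)^{1/2})$, and let $\|\cdot\|$ be the operator norm on $M_n(\mathbb C)$. For $x_1,\dots,x_d\in M_n(\mathbb C)$ put $$|||\{x_i\}|||^*=\inf\Big\{\mathrm{Tr}\Big(\big(\textstyle\sum_i y_i^*y_i\big)^{1/2}+\big(\sum_i z_iz_i^*\big)^{1/2}\Big): x_i=y_i+z_i,\ y_i,z_i\in M_n(\mathbb C)\Big\},$$ $$|||\{x_i\}|||_{M_n(\mathbb C^d)}=\max\Big\{\big\|\textstyle\sum_i x_i^*x_i\big\|^{1/2},\ \big\|\sum_i x_ix_i^*\big\|^{1/2}\Big\}.$$ (1) For every positive integer $n$ and all $x_1,\dots,x_d\in M_n(\mathbb C)$, the function $\omega\mapsto\big\|\sum_i\gamma_i(\omega)x_i\big\|_1$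 is integrable and $$\frac1{\sqrt2}\,|||\{x_i\}|||^*\ \le\ \int_\Omega\Big\|\sum_{i=1}^d\gamma_i(\omega)x_i\Big\|_1\,d\mathbb P(\omega)\ \le\ |||\{x_i\}|||^*.$$ (2) Let $E:L^\infty(\Omega)\to\mathbb C^d$, $E(f)=(\phi_1(f),\dots,\phi_d(f))$, where $\phi_i(f)=\int_\Omega f\,\overline{\gamma_i}\,d\mathbb P$, and let $q:L^\infty(\Omega)\to L^\infty(\Omega)/\mathrm{Ker}(E)$ be the quotient map. Equip $M_n(L^\infty(\Omega))=L^\infty(\Omega;M_n(\mathbb C))$ with the norm $\operatorname{ess\,sup}_\omega\|X(\omega)\|$ and $M_n(L^\infty(\Omega)/\mathrm{Ker}(E))=M_n(L^\infty(\Omega))/M_n(\mathrm{Ker}(E))$ with the quotient norm. Then for every positive integer $n$ and every $X\in M_n(L^\infty(\Omega))$, with $x_i=(\mathrm{Id}_n\otimes\phi_i)(X)$ (that is, $\phi_i$ applied to each entry of $X$), $$|||\{x_i\}|||_{M_n(\mathbb C^d)}\ \le\ \|(\mathrm{Id}_n\otimes q)(X)\|_{M_n(L^\infty(\Omega)/\mathrm{Ker}(E))}\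 \le\ \sqrt2\,|||\{x_i\}|||_{M_n(\mathbb C^d)}.$$ -/

import Mathlib

namespace NCKhintchine

noncomputable section

section MatrixNorms

open scoped Matrix Matrix.Norms.L2Operator MatrixOrder

/-- The non-normalized trace of the positive square root of `A`, for a positive
semidefinite complex matrix `A`; this trace is a nonnegative real number. -/
def trSqrt {n : ℕ} (A : Matrix (Fin n) (Fin n) ℂ) : ℝ :=
  (Matrix.trace (CFC.sqrt A)).re

/-- The norm of `S_1^n`: `‖x‖₁ = Tr ((x^* x)^{1/2})`. -/
def traceNorm {n : ℕ} (x : Matrix (Fin n) (Fin n) ℂ) : ℝ :=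
  trSqrt (xᴴ * x)

/-- The norm `|||{x_i}|||^*`: the infimum of
`Tr ((∑ y_i^* y_i)^{1/2} + (∑ z_i z_i^*)^{1/2})` over all splittings `x_i = y_i + z_i`. -/
def dualTripleNorm {d n : ℕ} (x : Fin d → Matrix (Fin n) (Fin n) ℂ) : ℝ :=
  sInf {r : ℝ | ∃ y z : Fin d → Matrix (Fin n) (Fin n) ℂ, (∀ i, x i = y i + z i) ∧
    r = trSqrt (∑ i, (y i)ᴴ * y i) + trSqrt (∑ i, z i * (z i)ᴴ)}

/-- The norm `|||{x_i}|||` on `M_n(ℂ^d)`: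
`max (‖∑ x_i^* x_i‖^{1/2}) (‖∑ x_i x_i^*‖^{1/2})`, with the operator norm on `M_n(ℂ)`. -/
def tripleNorm {d n : ℕ} (x : Fin d → Matrix (Fin n) (Fin n) ℂ) : ℝ :=
  max (Real.sqrt ‖∑ i, (x i)ᴴ * x i‖) (Real.sqrt ‖∑ i, x i * (x i)ᴴ‖)

end MatrixNorms

section Gaussian

open MeasureTheory ProbabilityTheory

/-- The standard complex Gaussian law, with density `π⁻¹ exp (-|z|²)` with respect to
Lebesgue measure on `ℂ`. -/
def stdComplexGaussian : Measure ℂ :=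
  volume.withDensity fun z : ℂ => ENNReal.ofReal (Real.pi⁻¹ * Real.exp (-‖z‖ ^ 2))

theorem integrable_id_stdComplexGaussian :
    Integrable (fun z : ℂ => z) stdComplexGaussian := by
  have hmeas : Measurable fun z : ℂ =>
      ENNReal.ofReal (Real.pi⁻¹ * Real.exp (-‖z‖ ^ 2)) := by fun_prop
  unfold stdComplexGaussian
  rw [integrable_withDensity_iff_integrable_smul' hmeas
    (Filter.Eventually.of_forall fun _ => ENNReal.ofReal_lt_top)]
  have h1 := (GaussianFourier.integrable_cexp_neg_mul_sq_norm_add (V := ℂ) (b := 1 / 2)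
    (by norm_num) 0 0).norm
  refine h1.mono' (by fun_prop) (Filter.Eventually.of_forall fun z => ?_)
  rw [norm_smul, Complex.norm_exp]
  have h2 : ((-(1 / 2 : ℂ) * (‖z‖ : ℂ) ^ 2 + 0 * (inner ℝ (0 : ℂ) z : ℝ)).re : ℝ)
      = -‖z‖ ^ 2 / 2 := by
    have : (-(1 / 2 : ℂ) * (‖z‖ : ℂ) ^ 2 + 0 * (inner ℝ (0 : ℂ) z : ℝ))
        = ((-‖z‖ ^ 2 / 2 : ℝ) : ℂ) := by push_cast; ring
    rw [this, Complex.ofReal_re]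
  rw [h2, ENNReal.toReal_ofReal (by positivity), Real.norm_of_nonneg (by positivity)]
  have h3 : ‖z‖ ≤ Real.exp (‖z‖ ^ 2 / 2) := by
    have := Real.add_one_le_exp (‖z‖ ^ 2 / 2)
    nlinarith [sq_nonneg (‖z‖ - 1)]
  have h4 : Real.pi⁻¹ ≤ 1 := inv_le_one_of_one_le₀ (by linarith [Real.pi_gt_three])
  calc Real.pi⁻¹ * Real.exp (-‖z‖ ^ 2) * ‖z‖
      ≤ 1 * Real.exp (-‖z‖ ^ 2) * Real.exp (‖z‖ ^ 2 / 2) := by gcongr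
    _ = Real.exp (-‖z‖ ^ 2 / 2) := by
        rw [one_mul, ← Real.exp_add]; congr 1; ring

variable {Ω : Type*} [MeasurableSpace Ω]

theorem integrable_of_hasLaw {P : Measure Ω} {γ : Ω → ℂ}
    (h : HasLaw γ stdComplexGaussian P) : Integrable γ P := by
  have h1 := integrable_id_stdComplexGaussian
  rw [← h.map_eq] at h1
  exact h1.comp_aemeasurable h.aemeasurable

theorem integrable_mul_conj {P : Measure Ω} {γ : Ω → ℂ} (h : Integrable γ P)
    (f : Lp ℂ ⊤ P) : Integrable (fun ω => f ω * (starRingEnd ℂ) (γ ω)) P := by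
  have h1 : Integrable (fun ω => (starRingEnd ℂ) (γ ω)) P :=
    Complex.conjCLE.toContinuousLinearMap.integrable_comp h
  exact h1.mul_of_top_right (Lp.memLp f)

/-- The map `φ : L^∞(Ω) → ℂ`, `φ(f) = ∫ f(ω) conj(γ(ω)) dP(ω)`. -/
def pairing {P : Measure Ω} {γ : Ω → ℂ} (h : Integrable γ P) : Lp ℂ ⊤ P →ₗ[ℂ] ℂ where
  toFun f := ∫ ω, f ω * (starRingEnd ℂ) (γ ω) ∂P
  map_add' f g := by
    rw [← integral_add (integrable_mul_conj h f) (integrable_mul_conj h g)]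
    refine integral_congr_ae ?_
    filter_upwards [Lp.coeFn_add f g] with ω hω
    rw [hω, Pi.add_apply, add_mul]
  map_smul' c f := by
    rw [RingHom.id_apply, smul_eq_mul, ← integral_const_mul]
    refine integral_congr_ae ?_
    filter_upwards [Lp.coeFn_smul c f] with ω hω
    rw [hω, Pi.smul_apply, smul_eq_mul, mul_assoc]

/-- The map `E : L^∞(Ω) → ℂ^d`, `E(f) = (φ_1(f), …, φ_d(f))`. -/
def pairingMap {P : Measure Ω} {d : ℕ} {γ : Fin d → Ω → ℂ} (h : ∀ i, Integrable (γ i) P) :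
    Lp ℂ ⊤ P →ₗ[ℂ] (Fin d → ℂ) :=
  LinearMap.pi fun i => pairing (h i)

open scoped Matrix.Norms.L2Operator in
/-- The norm of `M_n(L^∞(Ω)) = L^∞(Ω; M_n(ℂ))`: the essential supremum of the
operator norm of `X(ω)`. -/
def linftyMatrixNorm {P : Measure Ω} {n : ℕ} (X : Matrix (Fin n) (Fin n) (Lp ℂ ⊤ P)) : ℝ :=
  (eLpNorm (fun ω => (Matrix.of fun k l => X k l ω : Matrix (Fin n) (Fin n) ℂ)) ⊤ P).toReal

/-- The matrix norms of the quotient operator space `L^∞(Ω)/W`, that is, the quotient norm of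
`M_n(L^∞(Ω))/M_n(W)`: the infimum of the norms of all lifts to `M_n(L^∞(Ω))`. -/
def quotientMatrixNorm {P : Measure Ω} {n : ℕ} (W : Submodule ℂ (Lp ℂ ⊤ P))
    (ξ : Matrix (Fin n) (Fin n) (Lp ℂ ⊤ P ⧸ W)) : ℝ :=
  sInf {r : ℝ | ∃ X : Matrix (Fin n) (Fin n) (Lp ℂ ⊤ P),
    X.map W.mkQ = ξ ∧ r = linftyMatrixNorm X}

end Gaussian

end

end NCKhintchine

/-! The heart of the matter is a lifting statement: if `tripleNorm x ≤ t`, then for every ε > 0 some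
matrix function Y with ‖Y(ω)‖ ≤ √2·t + ε satisfies ∫ Y·conj γ_i = x_i for all i. The upper estimate
in (2) is exactly this. The lower estimate in (1) follows by duality: Hahn–Banach gives w with
`tripleNorm w ≤ 1` and |||x|||^* = Re ∑ Tr(x_i w_i^*); lifting w to Y turns this into ∫ Re Tr((∑ γ_i
x_i) Y^*), at most (√2 + ε) ∫ ‖∑ γ_i x_i‖₁.

To lift, truncate the unbounded lift S = ∑ γ_i x_i to S(1 + s S^*S)⁻¹, whose norm is at most
1/(2√s). The error satisfies |(S − S(1 + s S^*S)⁻¹)v|² ≤ (s/4)|S^*S v|². The Wick formula for fourth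
moments gives E|S^*S v|² ≤ 2t⁴|v|², and Bessel's inequality passes this to coefficients. With s =
1/(2t²) the truncation has norm at most √2·t/2 and leaves coefficients of triple norm at most t/2.
Iterating on the residue costs √2·t(1/2 + 1/4 + ⋯) = √2·t. After finitely many rounds a small
bounded correction makes the coefficients exact.

The other two estimates are soft. Bessel's inequality bounds the coefficients of any lift, which is
the lower estimate in (2). The upper estimate in (1) is Jensen's inequality for A ↦ Tr √A, used in
the variational form 2 Tr √A ≤ Tr(A D⁻¹) + Tr D, whose right side is affine in A. Rows are reduced
to columns by taking adjoints and replacing γ by its conjugate. -/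

namespace NCKhintchine

open Matrix
open scoped Matrix.Norms.L2Operator MatrixOrder ComplexOrder

/-! ### Quadratic forms, and trace duality for the column norm -/

section MatrixLemmas

variable {d n : ℕ}

/-- The squared Euclidean norm of a complex vector. -/
noncomputable def nsq (u : Fin n → ℂ) : ℝ := ∑ k, ‖u k‖ ^ 2

theorem nsq_nonneg (u : Fin n → ℂ) : 0 ≤ nsq u := Finset.sum_nonneg fun _ _ => by positivity

theorem star_dotProduct_self (u : Fin n → ℂ) : star u ⬝ᵥ u = (nsq u : ℂ) := by
  simp only [dotProduct, nsq, Pi.star_apply, Complex.ofReal_sum]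
  refine Finset.sum_congr rfl fun k _ => ?_
  rw [RCLike.star_def, Complex.conj_mul', Complex.ofReal_pow]

theorem nsq_smul (c : ℂ) (u : Fin n → ℂ) : nsq (c • u) = ‖c‖ ^ 2 * nsq u := by
  simp [nsq, mul_pow, Finset.mul_sum]

theorem nsq_add (u v : Fin n → ℂ) :
    nsq (u + v) = nsq u + 2 * (star u ⬝ᵥ v).re + nsq v := by
  have h : star v ⬝ᵥ u = star (star u ⬝ᵥ v) := by
    rw [star_dotProduct, dotProduct_comm]
  have : ((nsq (u + v) : ℝ) : ℂ) = nsq u + (star u ⬝ᵥ v + star (star u ⬝ᵥ v)) + nsq v := by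
    rw [← star_dotProduct_self, ← star_dotProduct_self, ← star_dotProduct_self, ← h, star_add,
      add_dotProduct, dotProduct_add, dotProduct_add]
    ring
  have h2 := congrArg Complex.re this
  simp at h2
  linarith

theorem star_dotProduct_conjTranspose_mul_mulVec {m : ℕ} (y : Matrix (Fin m) (Fin n) ℂ)
    (v : Fin n → ℂ) : star v ⬝ᵥ ((yᴴ * y) *ᵥ v) = (nsq (y *ᵥ v) : ℂ) := by
  rw [← star_dotProduct_self, ← mulVec_mulVec, star_mulVec, dotProduct_mulVec]

/-- `‖∑ x_i^* x_i‖ ≤ s`, expressed through quadratic forms. -/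
def ColBound (x : Fin d → Matrix (Fin n) (Fin n) ℂ) (s : ℝ) : Prop :=
  ∀ v : Fin n → ℂ, ∑ i, nsq (x i *ᵥ v) ≤ s * nsq v

theorem star_dotProduct_sum_mulVec (x : Fin d → Matrix (Fin n) (Fin n) ℂ) (v : Fin n → ℂ) :
    star v ⬝ᵥ ((∑ i, (x i)ᴴ * x i) *ᵥ v) = ((∑ i, nsq (x i *ᵥ v) : ℝ) : ℂ) := by
  rw [sum_mulVec, dotProduct_sum, Complex.ofReal_sum]
  exact Finset.sum_congr rfl fun i _ => star_dotProduct_conjTranspose_mul_mulVec _ _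

theorem posSemidef_sum_conjTranspose_mul_self (x : Fin d → Matrix (Fin n) (Fin n) ℂ) :
    (∑ i, (x i)ᴴ * x i).PosSemidef :=
  posSemidef_sum _ fun _ _ => posSemidef_conjTranspose_mul_self _

theorem ColBound.posSemidef {x : Fin d → Matrix (Fin n) (Fin n) ℂ} {s : ℝ} (h : ColBound x s) :
    ((s : ℂ) • (1 : Matrix (Fin n) (Fin n) ℂ) - ∑ i, (x i)ᴴ * x i).PosSemidef := by
  refine PosSemidef.of_dotProduct_mulVec_nonneg ?_ fun v => ?_
  · refine IsHermitian.sub ?_ (posSemidef_sum_conjTranspose_mul_self x).isHermitian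
    simp [IsHermitian, conjTranspose_smul]
  · rw [sub_mulVec, dotProduct_sub, star_dotProduct_sum_mulVec, smul_mulVec, one_mulVec,
      dotProduct_smul, star_dotProduct_self, smul_eq_mul, ← Complex.ofReal_mul,
      ← Complex.ofReal_sub, Complex.zero_le_real]
    exact sub_nonneg.2 (h v)

theorem colBound_iff {x : Fin d → Matrix (Fin n) (Fin n) ℂ} {s : ℝ} (hs : 0 ≤ s) :
    ColBound x s ↔ ‖∑ i, (x i)ᴴ * x i‖ ≤ s := by
  rw [CStarAlgebra.norm_le_iff_le_algebraMap _ hs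
    (posSemidef_sum_conjTranspose_mul_self x).nonneg, Matrix.le_iff, Algebra.algebraMap_eq_smul_one]
  have e : (s • (1 : Matrix (Fin n) (Fin n) ℂ)) = (s : ℂ) • 1 := by
    ext; simp
  rw [e]
  refine ⟨fun h => h.posSemidef, fun h v => ?_⟩
  have := h.dotProduct_mulVec_nonneg v
  rw [sub_mulVec, dotProduct_sub, star_dotProduct_sum_mulVec, smul_mulVec, one_mulVec,
      dotProduct_smul, star_dotProduct_self, smul_eq_mul, ← Complex.ofReal_mul,
      ← Complex.ofReal_sub, Complex.zero_le_real] at this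
  exact sub_nonneg.1 this

theorem tripleNorm_le_iff {x : Fin d → Matrix (Fin n) (Fin n) ℂ} {t : ℝ} (ht : 0 ≤ t) :
    tripleNorm x ≤ t ↔ ColBound x (t ^ 2) ∧ ColBound (fun i => (x i)ᴴ) (t ^ 2) := by
  rw [tripleNorm, max_le_iff, Real.sqrt_le_left ht, Real.sqrt_le_left ht,
    colBound_iff (by positivity), colBound_iff (by positivity)]
  simp

theorem tripleNorm_nonneg (x : Fin d → Matrix (Fin n) (Fin n) ℂ) : 0 ≤ tripleNorm x :=
  le_max_of_le_left (Real.sqrt_nonneg _)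

theorem norm_le_iff_nsq {A : Matrix (Fin n) (Fin n) ℂ} {t : ℝ} (ht : 0 ≤ t) :
    ‖A‖ ≤ t ↔ ∀ v, nsq (A *ᵥ v) ≤ t ^ 2 * nsq v := by
  have h := colBound_iff (d := 1) (x := fun _ => A) (s := t ^ 2) (by positivity)
  simp only [ColBound, Finset.univ_unique, Finset.sum_const, Finset.card_singleton, one_smul,
    l2_opNorm_conjTranspose_mul_self] at h
  rw [h, ← sq, sq_le_sq₀ (norm_nonneg _) ht]

theorem trace_mul_re_nonneg {A B : Matrix (Fin n) (Fin n) ℂ} (hA : A.PosSemidef)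
    (hB : B.PosSemidef) : 0 ≤ (trace (A * B)).re := by
  obtain ⟨C, rfl⟩ := CStarAlgebra.nonneg_iff_eq_star_mul_self.1 hB.nonneg
  rw [star_eq_conjTranspose, ← mul_assoc, trace_mul_comm, ← mul_assoc]
  exact (Complex.le_def.1 (hA.mul_mul_conjTranspose_same C).trace_nonneg).1

/-- A weighted arithmetic–geometric inequality: expand Tr((yD⁻¹ − w) D (yD⁻¹ − w)^*) ≥ 0. -/
theorem two_mul_trace_mul_conjTranspose_le {D : Matrix (Fin n) (Fin n) ℂ} (hD : D.PosDef)
    (y w : Matrix (Fin n) (Fin n) ℂ) :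
    2 * (trace (y * wᴴ)).re ≤ (trace (yᴴ * y * D⁻¹)).re + (trace (wᴴ * w * D)).re := by
  have hu : IsUnit D.det := (isUnit_iff_isUnit_det _).1 hD.isUnit
  have h := (Complex.le_def.1
    (hD.posSemidef.mul_mul_conjTranspose_same (y * D⁻¹ - w)).trace_nonneg).1
  have e : (y * D⁻¹ - w) * D * (y * D⁻¹ - w)ᴴ
      = y * D⁻¹ * yᴴ - y * wᴴ - w * yᴴ + w * D * wᴴ := by
    have h1 : (D⁻¹)ᴴ = D⁻¹ := hD.inv.isHermitian
    rw [conjTranspose_sub, conjTranspose_mul, h1, sub_mul, mul_assoc y, nonsing_inv_mul _ hu,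
      mul_one, sub_mul, mul_sub, mul_sub]
    have h2 : w * D * (D⁻¹ * yᴴ) = w * yᴴ := by
      rw [mul_assoc, ← mul_assoc D, mul_nonsing_inv _ hu, one_mul]
    rw [h2, ← mul_assoc]
    abel
  have h3 : (trace (w * yᴴ)).re = (trace (y * wᴴ)).re := by
    have : w * yᴴ = (y * wᴴ)ᴴ := by simp
    rw [this, trace_conjTranspose]; simp
  have h4 : trace (y * D⁻¹ * yᴴ) = trace (yᴴ * y * D⁻¹) := by
    rw [trace_mul_comm, ← mul_assoc]
  have h5 : trace (w * D * wᴴ) = trace (wᴴ * w * D) := by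
    rw [trace_mul_comm, ← mul_assoc]
  rw [e, trace_add, trace_sub, trace_sub, h4, h5] at h
  simp only [Complex.zero_re, Complex.add_re, Complex.sub_re, h3] at h
  linarith

theorem ColBound.trace_mul_le {w : Fin d → Matrix (Fin n) (Fin n) ℂ} (hw : ColBound w 1)
    {D : Matrix (Fin n) (Fin n) ℂ} (hD : D.PosSemidef) :
    ∑ i, (trace ((w i)ᴴ * w i * D)).re ≤ (trace D).re := by
  have h := trace_mul_re_nonneg hw.posSemidef hD
  rw [Complex.ofReal_one, one_smul, sub_mul, one_mul, trace_sub, Complex.sub_re, Finset.sum_mul,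
    trace_sum, Complex.re_sum] at h
  linarith

theorem two_mul_sum_trace_le {D : Matrix (Fin n) (Fin n) ℂ} (hD : D.PosDef)
    (y w : Fin d → Matrix (Fin n) (Fin n) ℂ) (hw : ColBound w 1) :
    2 * ∑ i, (trace (y i * (w i)ᴴ)).re
      ≤ (trace ((∑ i, (y i)ᴴ * y i) * D⁻¹)).re + (trace D).re := by
  have h := Finset.sum_le_sum fun i (_ : i ∈ Finset.univ) =>
    two_mul_trace_mul_conjTranspose_le hD (y i) (w i)
  rw [← Finset.mul_sum, Finset.sum_add_distrib] at h
  rw [Finset.sum_mul, trace_sum, Complex.re_sum]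
  linarith [hw.trace_mul_le hD.posSemidef]

/-- Take y = √A and w = 1 in the weighted inequality. For invertible A equality holds at D = √A; the
bound being affine in A is what allows integration later. -/
theorem two_mul_trSqrt_le {A D : Matrix (Fin n) (Fin n) ℂ} (hA : A.PosSemidef) (hD : D.PosDef) :
    2 * trSqrt A ≤ (trace (A * D⁻¹)).re + (trace D).re := by
  have h1 : (CFC.sqrt A)ᴴ = CFC.sqrt A :=
    (Matrix.nonneg_iff_posSemidef.1 (CFC.sqrt_nonneg A)).isHermitian
  have h := two_mul_trace_mul_conjTranspose_le hD (CFC.sqrt A) 1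
  rw [h1, CFC.sqrt_mul_sqrt_self A hA.nonneg] at h
  simpa [trSqrt] using h

theorem trSqrt_nonneg (A : Matrix (Fin n) (Fin n) ℂ) : 0 ≤ trSqrt A :=
  (Complex.le_def.1 (Matrix.nonneg_iff_posSemidef.1 (CFC.sqrt_nonneg A)).trace_nonneg).1

/-- The optimal weight would be √T, which may be singular; √T + ε replaces it throughout, at a cost
in trace of order εn. -/
theorem posDef_sqrt_add (T : Matrix (Fin n) (Fin n) ℂ) {ε : ℝ} (hε : 0 < ε) :
    (CFC.sqrt T + (ε : ℂ) • 1).PosDef :=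
  PosDef.posSemidef_add (Matrix.nonneg_iff_posSemidef.1 (CFC.sqrt_nonneg T))
    (PosDef.one.smul (by exact_mod_cast hε))

theorem sqrt_mul_inv (T : Matrix (Fin n) (Fin n) ℂ) {ε : ℝ} (hε : 0 < ε) :
    CFC.sqrt T * (CFC.sqrt T + (ε : ℂ) • 1)⁻¹
      = 1 - (ε : ℂ) • (CFC.sqrt T + (ε : ℂ) • 1)⁻¹ := by
  have hu := (isUnit_iff_isUnit_det _).1 (posDef_sqrt_add T hε).isUnit
  have h := mul_nonsing_inv _ hu
  rw [add_mul, smul_mul_assoc, one_mul] at h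
  exact eq_sub_of_add_eq h

theorem mul_inv_sqrt_add {T : Matrix (Fin n) (Fin n) ℂ} (hT : T.PosSemidef) {ε : ℝ}
    (hε : 0 < ε) :
    T * (CFC.sqrt T + (ε : ℂ) • 1)⁻¹
      = CFC.sqrt T - (ε : ℂ) • (CFC.sqrt T * (CFC.sqrt T + (ε : ℂ) • 1)⁻¹) := by
  have h : T * (CFC.sqrt T + (ε : ℂ) • 1)⁻¹
      = CFC.sqrt T * (CFC.sqrt T * (CFC.sqrt T + (ε : ℂ) • 1)⁻¹) := by
    rw [← mul_assoc, CFC.sqrt_mul_sqrt_self T hT.nonneg]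
  rw [h, sqrt_mul_inv T hε, mul_sub, mul_one, mul_smul_comm, sqrt_mul_inv T hε]

theorem trace_mul_inv_sqrt_add_le {T : Matrix (Fin n) (Fin n) ℂ} (hT : T.PosSemidef) {ε : ℝ}
    (hε : 0 < ε) : (trace (T * (CFC.sqrt T + (ε : ℂ) • 1)⁻¹)).re ≤ trSqrt T := by
  rw [mul_inv_sqrt_add hT hε, trace_sub, trace_smul, Complex.sub_re, smul_eq_mul,
    Complex.re_ofReal_mul]
  have := trace_mul_re_nonneg (Matrix.nonneg_iff_posSemidef.1 (CFC.sqrt_nonneg T))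
    (posDef_sqrt_add T hε).posSemidef.inv
  rw [trSqrt]
  nlinarith

/-- With D = √T + ε one has T D⁻¹ = √T − ε + ε² D⁻¹, and the last term has nonnegative trace. -/
theorem le_trace_mul_inv_sqrt_add {T : Matrix (Fin n) (Fin n) ℂ} (hT : T.PosSemidef) {ε : ℝ}
    (hε : 0 < ε) : trSqrt T - ε * n ≤ (trace (T * (CFC.sqrt T + (ε : ℂ) • 1)⁻¹)).re := by
  rw [mul_inv_sqrt_add hT hε, trace_sub, trace_smul, Complex.sub_re, smul_eq_mul,
    Complex.re_ofReal_mul, sqrt_mul_inv T hε, trace_sub, trace_smul, Complex.sub_re, smul_eq_mul,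
    Complex.re_ofReal_mul, trace_one]
  have := (Complex.le_def.1 (posDef_sqrt_add T hε).posSemidef.inv.trace_nonneg).1
  simp only [trSqrt, Fintype.card_fin, Complex.natCast_re, Complex.zero_re] at *
  nlinarith [mul_nonneg (mul_nonneg hε.le hε.le) this]

theorem trace_sqrt_add (T : Matrix (Fin n) (Fin n) ℂ) (ε : ℝ) :
    (trace (CFC.sqrt T + (ε : ℂ) • 1)).re = trSqrt T + ε * n := by
  simp [trSqrt, trace_add, trace_smul]

theorem le_of_forall_pos_mul_add {a b c : ℝ} (hc : 0 ≤ c) (h : ∀ ε : ℝ, 0 < ε → a ≤ b + ε * c) :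
    a ≤ b := by
  refine le_of_forall_pos_le_add fun ε hε => ?_
  refine (h (ε / (c + 1)) (by positivity)).trans ?_
  gcongr
  rw [div_mul_eq_mul_div, div_le_iff₀ (by positivity)]
  nlinarith

theorem sum_trace_le_trSqrt (y w : Fin d → Matrix (Fin n) (Fin n) ℂ) (hw : ColBound w 1) :
    ∑ i, (trace (y i * (w i)ᴴ)).re ≤ trSqrt (∑ i, (y i)ᴴ * y i) := by
  refine le_of_forall_pos_mul_add (c := n / 2) (by positivity) fun ε hε => ?_
  have hT := posSemidef_sum_conjTranspose_mul_self y
  have h := two_mul_sum_trace_le (posDef_sqrt_add (∑ i, (y i)ᴴ * y i) hε) y w hw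
  rw [trace_sqrt_add] at h
  linarith [trace_mul_inv_sqrt_add_le hT hε]

/-- Writing v = (√T + ε)u, the sum becomes |√T u|², while |v|² exceeds it by a nonnegative cross
term and |εu|². -/
theorem colBound_mul_inv_sqrt_add (y : Fin d → Matrix (Fin n) (Fin n) ℂ) {ε : ℝ} (hε : 0 < ε) :
    ColBound (fun i => y i * (CFC.sqrt (∑ i, (y i)ᴴ * y i) + (ε : ℂ) • 1)⁻¹) 1 := by
  intro v
  set T := ∑ i, (y i)ᴴ * y i with hTdef
  have hT : T.PosSemidef := posSemidef_sum_conjTranspose_mul_self y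
  have ht := Matrix.nonneg_iff_posSemidef.1 (CFC.sqrt_nonneg T)
  set D := CFC.sqrt T + (ε : ℂ) • (1 : Matrix (Fin n) (Fin n) ℂ) with hD
  have hu := (isUnit_iff_isUnit_det _).1 (posDef_sqrt_add T hε).isUnit
  set u := D⁻¹ *ᵥ v with hu'
  have hv : v = CFC.sqrt T *ᵥ u + (ε : ℂ) • u := by
    have : v = D *ᵥ u := by rw [hu', mulVec_mulVec, mul_nonsing_inv _ hu, one_mulVec]
    rw [this, hD, add_mulVec, smul_mulVec, one_mulVec]
  have h1 : ∑ i, nsq ((y i * D⁻¹) *ᵥ v) = nsq (CFC.sqrt T *ᵥ u) := by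
    have e := star_dotProduct_conjTranspose_mul_mulVec (CFC.sqrt T) u
    rw [show (CFC.sqrt T)ᴴ = CFC.sqrt T from ht.isHermitian, CFC.sqrt_mul_sqrt_self T hT.nonneg,
      hTdef, star_dotProduct_sum_mulVec] at e
    simp only [← mulVec_mulVec]
    exact_mod_cast e
  have h2 : 0 ≤ (star (CFC.sqrt T *ᵥ u) ⬝ᵥ u).re := by
    have := (Complex.le_def.1 (ht.dotProduct_mulVec_nonneg u)).1
    rwa [star_mulVec, ← dotProduct_mulVec,
      show (CFC.sqrt T)ᴴ = CFC.sqrt T from ht.isHermitian]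
  rw [h1, one_mul, hv, nsq_add, dotProduct_smul, smul_eq_mul, Complex.re_ofReal_mul]
  nlinarith [nsq_nonneg ((ε : ℂ) • u), mul_nonneg hε.le h2]

/-- Near-attainment in the duality: the witness is the regularized polar part y_i (√T + ε)⁻¹ of the
column y. -/
theorem exists_colBound_trSqrt_sub_le (y : Fin d → Matrix (Fin n) (Fin n) ℂ) {ε : ℝ}
    (hε : 0 < ε) : ∃ w : Fin d → Matrix (Fin n) (Fin n) ℂ, ColBound w 1 ∧
      trSqrt (∑ i, (y i)ᴴ * y i) ≤ ∑ i, (trace (y i * (w i)ᴴ)).re + ε * n := by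
  refine ⟨_, colBound_mul_inv_sqrt_add y hε, ?_⟩
  have hT := posSemidef_sum_conjTranspose_mul_self y
  have h := le_trace_mul_inv_sqrt_add hT hε
  have h1 := (posDef_sqrt_add (∑ i, (y i)ᴴ * y i) hε).inv.isHermitian
  set D := CFC.sqrt (∑ i, (y i)ᴴ * y i) + (ε : ℂ) • (1 : Matrix (Fin n) (Fin n) ℂ)
  have e : ∑ i, (trace (y i * (y i * D⁻¹)ᴴ)).re = (trace ((∑ i, (y i)ᴴ * y i) * D⁻¹)).re := by
    rw [Finset.sum_mul, trace_sum, Complex.re_sum]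
    refine Finset.sum_congr rfl fun i _ => ?_
    rw [conjTranspose_mul, show (D⁻¹)ᴴ = D⁻¹ from h1, trace_mul_comm,
      trace_mul_cycle, trace_mul_cycle, mul_assoc]
  rw [e]
  linarith

/-- By the duality, the column norm is a supremum of linear functionals, hence subadditive. -/
theorem trSqrt_sum_add_le (y z : Fin d → Matrix (Fin n) (Fin n) ℂ) :
    trSqrt (∑ i, (y i + z i)ᴴ * (y i + z i))
      ≤ trSqrt (∑ i, (y i)ᴴ * y i) + trSqrt (∑ i, (z i)ᴴ * z i) := by
  refine le_of_forall_pos_mul_add (c := n) (by positivity) fun ε hε => ?_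
  obtain ⟨w, hw, h⟩ := exists_colBound_trSqrt_sub_le (fun i => y i + z i) hε
  refine h.trans ?_
  have h1 := sum_trace_le_trSqrt y w hw
  have h2 := sum_trace_le_trSqrt z w hw
  simp only [add_mul, trace_add, Complex.add_re, Finset.sum_add_distrib]
  linarith

theorem trSqrt_smul {c : ℝ} (hc : 0 ≤ c) {A : Matrix (Fin n) (Fin n) ℂ} (hA : A.PosSemidef) :
    trSqrt (((c ^ 2 : ℝ) : ℂ) • A) = c * trSqrt A := by
  have h : CFC.sqrt (((c ^ 2 : ℝ) : ℂ) • A) = (c : ℂ) • CFC.sqrt A := by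
    refine CFC.sqrt_unique ?_ ?_
    · rw [smul_mul_smul_comm, CFC.sqrt_mul_sqrt_self A hA.nonneg]
      push_cast; rw [sq]
    · exact ((Matrix.nonneg_iff_posSemidef.1 (CFC.sqrt_nonneg A)).smul
        (by exact_mod_cast hc)).nonneg
  rw [trSqrt, h, trace_smul, smul_eq_mul, Complex.re_ofReal_mul, trSqrt]

theorem trace_mul_le_traceNorm {w : Matrix (Fin n) (Fin n) ℂ} (hw : ‖w‖ ≤ 1)
    (x : Matrix (Fin n) (Fin n) ℂ) : (trace (x * wᴴ)).re ≤ traceNorm x := by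
  have h := sum_trace_le_trSqrt (d := 1) (fun _ => x) (fun _ => w) (by
    intro v; simpa using (norm_le_iff_nsq zero_le_one).1 hw v)
  simpa [traceNorm] using h

theorem exists_traceNorm_sub_le (x : Matrix (Fin n) (Fin n) ℂ) {ε : ℝ} (hε : 0 < ε) :
    ∃ w : Matrix (Fin n) (Fin n) ℂ, ‖w‖ ≤ 1 ∧ traceNorm x ≤ (trace (x * wᴴ)).re + ε * n := by
  obtain ⟨w, hw, h⟩ := exists_colBound_trSqrt_sub_le (d := 1) (fun _ => x) hε
  refine ⟨w 0, (norm_le_iff_nsq zero_le_one).2 fun v => ?_, by simpa [traceNorm] using h⟩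
  simpa using hw v

theorem traceNorm_add_le (x y : Matrix (Fin n) (Fin n) ℂ) :
    traceNorm (x + y) ≤ traceNorm x + traceNorm y := by
  simpa [traceNorm] using trSqrt_sum_add_le (d := 1) (fun _ => x) (fun _ => y)

theorem traceNorm_conjTranspose_le (x : Matrix (Fin n) (Fin n) ℂ) :
    traceNorm xᴴ ≤ traceNorm x := by
  refine le_of_forall_pos_mul_add (c := n) (by positivity) fun ε hε => ?_
  obtain ⟨w, hw, h⟩ := exists_traceNorm_sub_le xᴴ hε
  refine h.trans (add_le_add ?_ le_rfl)
  have h1 := trace_mul_le_traceNorm (w := wᴴ) (by rwa [l2_opNorm_conjTranspose]) x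
  have e : xᴴ * wᴴ = (w * x)ᴴ := by simp
  rw [e, trace_conjTranspose, trace_mul_comm]
  simpa using h1

theorem traceNorm_conjTranspose (x : Matrix (Fin n) (Fin n) ℂ) : traceNorm xᴴ = traceNorm x :=
  le_antisymm (traceNorm_conjTranspose_le x) (by simpa using traceNorm_conjTranspose_le xᴴ)

theorem trace_mul_le_mul_traceNorm {w : Matrix (Fin n) (Fin n) ℂ} {c : ℝ} (hc : 0 < c)
    (hw : ‖w‖ ≤ c) (x : Matrix (Fin n) (Fin n) ℂ) :
    (trace (x * wᴴ)).re ≤ c * traceNorm x := by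
  have h := trace_mul_le_traceNorm (w := ((c⁻¹ : ℝ) : ℂ) • w) (by
    rw [norm_smul, Complex.norm_real, Real.norm_of_nonneg (by positivity)]
    rw [inv_mul_le_iff₀ hc]; simpa using hw) x
  rw [conjTranspose_smul, mul_smul_comm, trace_smul, smul_eq_mul, RCLike.star_def,
    Complex.conj_ofReal, Complex.re_ofReal_mul, inv_mul_le_iff₀ hc] at h
  exact h

end MatrixLemmas

end NCKhintchine

namespace NCKhintchine

open Matrix
open scoped Matrix.Norms.L2Operator MatrixOrder ComplexOrder

/-! ### Duality between the two triple norms -/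

section Duality

variable {d n : ℕ}

theorem dualTripleNorm_le {x y z : Fin d → Matrix (Fin n) (Fin n) ℂ}
    (h : ∀ i, x i = y i + z i) :
    dualTripleNorm x ≤ trSqrt (∑ i, (y i)ᴴ * y i) + trSqrt (∑ i, z i * (z i)ᴴ) :=
  csInf_le ⟨0, by rintro r ⟨y, z, -, rfl⟩; exact add_nonneg (trSqrt_nonneg _) (trSqrt_nonneg _)⟩
    ⟨y, z, h, rfl⟩

theorem le_dualTripleNorm {x : Fin d → Matrix (Fin n) (Fin n) ℂ} {c : ℝ}
    (h : ∀ y z : Fin d → Matrix (Fin n) (Fin n) ℂ, (∀ i, x i = y i + z i) →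
      c ≤ trSqrt (∑ i, (y i)ᴴ * y i) + trSqrt (∑ i, z i * (z i)ᴴ)) :
    c ≤ dualTripleNorm x := by
  refine le_csInf ⟨_, x, 0, by simp, rfl⟩ ?_
  rintro r ⟨y, z, hyz, rfl⟩
  exact h y z hyz

theorem dualTripleNorm_nonneg (x : Fin d → Matrix (Fin n) (Fin n) ℂ) : 0 ≤ dualTripleNorm x :=
  le_dualTripleNorm fun _ _ _ => add_nonneg (trSqrt_nonneg _) (trSqrt_nonneg _)

theorem dualTripleNorm_add_le (x x' : Fin d → Matrix (Fin n) (Fin n) ℂ) :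
    dualTripleNorm (x + x') ≤ dualTripleNorm x + dualTripleNorm x' := by
  rw [← sub_le_iff_le_add]
  refine le_dualTripleNorm fun y z h => ?_
  rw [sub_le_iff_le_add, ← sub_le_iff_le_add']
  refine le_dualTripleNorm fun y' z' h' => ?_
  rw [sub_le_iff_le_add']
  refine (dualTripleNorm_le (y := fun i => y i + y' i) (z := fun i => z i + z' i) fun i => ?_).trans
    ?_
  · rw [Pi.add_apply, h, h']; abel
  · have h1 := trSqrt_sum_add_le y y'
    have h2 := trSqrt_sum_add_le (fun i => (z i)ᴴ) (fun i => (z' i)ᴴ)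
    simp only [← conjTranspose_add, conjTranspose_conjTranspose] at h2
    linarith

theorem dualTripleNorm_smul_le {c : ℝ} (hc : 0 < c) (x : Fin d → Matrix (Fin n) (Fin n) ℂ) :
    dualTripleNorm (c • x) ≤ c * dualTripleNorm x := by
  rw [← inv_mul_le_iff₀ hc]
  refine le_dualTripleNorm fun y z h => ?_
  rw [inv_mul_le_iff₀ hc]
  refine (dualTripleNorm_le (y := fun i => (c : ℂ) • y i) (z := fun i => (c : ℂ) • z i)
    fun i => ?_).trans ?_
  · rw [Pi.smul_apply, h, ← smul_add]; ext; simp [mul_add]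
  · have h1 : ∀ a b : Matrix (Fin n) (Fin n) ℂ,
        ((c : ℂ) • a) * ((c : ℂ) • b) = ((c ^ 2 : ℝ) : ℂ) • (a * b) := fun a b => by
      rw [smul_mul_smul_comm]; push_cast; rw [sq]
    have h2 := posSemidef_sum_conjTranspose_mul_self y
    have h3 : (∑ i, z i * (z i)ᴴ).PosSemidef := by
      simpa using posSemidef_sum_conjTranspose_mul_self fun i => (z i)ᴴ
    simp only [conjTranspose_smul, RCLike.star_def, Complex.conj_ofReal, h1, ← Finset.smul_sum,
      trSqrt_smul hc.le h2, trSqrt_smul hc.le h3]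
    rw [mul_add]

theorem dualTripleNorm_smul {c : ℝ} (hc : 0 < c) (x : Fin d → Matrix (Fin n) (Fin n) ℂ) :
    dualTripleNorm (c • x) = c * dualTripleNorm x := by
  refine le_antisymm (dualTripleNorm_smul_le hc x) ?_
  have h := dualTripleNorm_smul_le (inv_pos.2 hc) (c • x)
  rwa [smul_smul, inv_mul_cancel₀ hc.ne', one_smul, le_inv_mul_iff₀ hc] at h

theorem trace_mul_conjTranspose_eq_sum (u w : Matrix (Fin n) (Fin n) ℂ) :
    trace (u * wᴴ) = ∑ k, ∑ l, u k l * star (w k l) := by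
  simp [trace, mul_apply]

theorem exists_eq_sum_trace (f : (Fin d → Matrix (Fin n) (Fin n) ℂ) →ₗ[ℝ] ℝ) :
    ∃ w : Fin d → Matrix (Fin n) (Fin n) ℂ, ∀ u, f u = ∑ i, (trace (u i * (w i)ᴴ)).re := by
  -- For real p, q, Re((a + ib)·conj(p + iq)) = ap + bq, so p and q must be the values of f on the
  -- matrix units E_kl and iE_kl.
  refine ⟨fun i => Matrix.of fun k l => (f (Pi.single i (Matrix.single k l 1)) : ℂ)
    + Complex.I * f (Pi.single i (Matrix.single k l Complex.I)), fun u => ?_⟩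
  have hu : u = ∑ i, ∑ k, ∑ l, ((u i k l).re •
        (Pi.single i (Matrix.single k l 1) : Fin d → Matrix (Fin n) (Fin n) ℂ)
      + (u i k l).im •
        (Pi.single i (Matrix.single k l Complex.I) : Fin d → Matrix (Fin n) (Fin n) ℂ)) := by
    funext i
    rw [matrix_eq_sum_single (u i), Finset.sum_apply, Finset.sum_eq_single i]
    · rw [Finset.sum_apply]
      refine Finset.sum_congr rfl fun k _ => ?_
      rw [Finset.sum_apply]
      refine Finset.sum_congr rfl fun l _ => ?_
      simp only [Pi.add_apply, Pi.smul_apply, Pi.single_eq_same, smul_single, ← single_add]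
      congr 1
      simp
    · intro j _ hj
      simp [Finset.sum_apply, Pi.single_eq_of_ne hj.symm]
    · simp
  conv_lhs => rw [hu]
  simp only [map_sum, map_add, map_smul, smul_eq_mul, trace_mul_conjTranspose_eq_sum,
    Complex.re_sum]
  refine Finset.sum_congr rfl fun i _ => Finset.sum_congr rfl fun k _ =>
    Finset.sum_congr rfl fun l _ => ?_
  simp

/-- Since (vv^*)² = |v|² vv^*, the square root of c·vv^* is (√c/|v|)·vv^*. -/
theorem trSqrt_smul_vecMulVec {c : ℝ} (hc : 0 ≤ c) (v : Fin n → ℂ) :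
    trSqrt ((c : ℂ) • vecMulVec v (star v)) = √c * √(nsq v) := by
  by_cases hv : nsq v = 0
  · have h0 : vecMulVec v (star v) = 0 := by
      have : trace (vecMulVec v (star v)) = 0 := by
        rw [trace_vecMulVec, dotProduct_comm, star_dotProduct_self, hv, Complex.ofReal_zero]
      exact (posSemidef_vecMulVec_self_star v).trace_eq_zero_iff.1 this
    simp [h0, hv, trSqrt]
  have hv' : 0 < nsq v := lt_of_le_of_ne (nsq_nonneg v) (Ne.symm hv)
  have h : CFC.sqrt ((c : ℂ) • vecMulVec v (star v))
      = ((√c / √(nsq v) : ℝ) : ℂ) • vecMulVec v (star v) := by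
    refine CFC.sqrt_unique ?_ ?_
    · rw [smul_mul_smul_comm, vecMulVec_mul_vecMulVec, star_dotProduct_self, vecMulVec_smul,
        smul_smul]
      congr 1
      rw [← Complex.ofReal_mul, ← Complex.ofReal_mul, div_mul_div_comm, Real.mul_self_sqrt hc,
        Real.mul_self_sqrt hv'.le, div_mul_cancel₀ _ hv]
    · refine ((posSemidef_vecMulVec_self_star v).smul ?_).nonneg
      rw [Complex.zero_le_real]; positivity
  rw [trSqrt, h, trace_smul, trace_vecMulVec, dotProduct_comm, star_dotProduct_self, smul_eq_mul,
    ← Complex.ofReal_mul, Complex.ofReal_re, div_mul_eq_mul_div, mul_div_assoc, Real.div_sqrt]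

/-- Converse half of the duality: test on the rank-one family u_i = w_i vv^*. With c = ∑ |w_i v|²
the hypothesis reads c ≤ √c·|v|. -/
theorem colBound_one_of_le {w : Fin d → Matrix (Fin n) (Fin n) ℂ}
    (h : ∀ u : Fin d → Matrix (Fin n) (Fin n) ℂ,
      ∑ i, (trace (u i * (w i)ᴴ)).re ≤ trSqrt (∑ i, (u i)ᴴ * u i)) : ColBound w 1 := by
  intro v
  set c := ∑ i, nsq (w i *ᵥ v) with hc
  have hc0 : 0 ≤ c := Finset.sum_nonneg fun _ _ => nsq_nonneg _
  have h1 := h fun i => w i * vecMulVec v (star v)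
  have e1 : ∑ i, (trace (w i * vecMulVec v (star v) * (w i)ᴴ)).re = c := by
    refine Finset.sum_congr rfl fun i _ => ?_
    rw [mul_vecMulVec, vecMulVec_mul, ← star_mulVec, trace_vecMulVec, dotProduct_comm,
      star_dotProduct_self, Complex.ofReal_re]
  have e2 : ∑ i, (w i * vecMulVec v (star v))ᴴ * (w i * vecMulVec v (star v))
      = (c : ℂ) • vecMulVec v (star v) := by
    rw [hc, Complex.ofReal_sum, Finset.sum_smul]
    refine Finset.sum_congr rfl fun i _ => ?_
    rw [mul_vecMulVec, conjTranspose_vecMulVec, vecMulVec_mul_vecMulVec, star_star,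
      star_dotProduct_self, vecMulVec_smul]
  rw [e1, e2, trSqrt_smul_vecMulVec hc0] at h1
  have h2 : c * c ≤ c * nsq v := by
    have := mul_le_mul h1 h1 hc0 (by positivity)
    rwa [mul_mul_mul_comm, Real.mul_self_sqrt hc0, Real.mul_self_sqrt (nsq_nonneg v)] at this
  rcases hc0.eq_or_lt with h0 | h0
  · rw [← h0, one_mul]; exact nsq_nonneg v
  · rw [one_mul]; exact le_of_mul_le_mul_left h2 h0

/-- The norm `dualTripleNorm` is attained on the unit ball of `tripleNorm`. -/
theorem exists_dualTripleNorm_eq (x : Fin d → Matrix (Fin n) (Fin n) ℂ) :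
    ∃ w : Fin d → Matrix (Fin n) (Fin n) ℂ, tripleNorm w ≤ 1 ∧
      dualTripleNorm x = ∑ i, (trace (x i * (w i)ᴴ)).re := by
  obtain ⟨f, hfx, hf⟩ : ∃ f : (Fin d → Matrix (Fin n) (Fin n) ℂ) →ₗ[ℝ] ℝ,
      f x = dualTripleNorm x ∧ ∀ u, f u ≤ dualTripleNorm u := by
    by_cases hx : x = 0
    · have h0 : dualTripleNorm (0 : Fin d → Matrix (Fin n) (Fin n) ℂ) = 0 := by
        have := dualTripleNorm_smul two_pos (0 : Fin d → Matrix (Fin n) (Fin n) ℂ)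
        rw [smul_zero] at this
        linarith
      exact ⟨0, by simp [hx, h0], fun u => dualTripleNorm_nonneg u⟩
    -- Hahn–Banach, extending c·x ↦ c|||x|||^* from the real line through x under the sublinear
    -- bound `dualTripleNorm`.
    obtain ⟨g, hg, hg'⟩ := exists_extension_of_le_sublinear
      (LinearPMap.mkSpanSingleton x (dualTripleNorm x) hx) dualTripleNorm
      (fun c hc x => dualTripleNorm_smul hc x) dualTripleNorm_add_le (by
        rintro ⟨u, hu⟩
        obtain ⟨c, rfl⟩ := Submodule.mem_span_singleton.1 hu
        rw [LinearPMap.mkSpanSingleton'_apply, RingHom.id_apply, smul_eq_mul]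
        rcases lt_or_ge 0 c with hc | hc
        · rw [dualTripleNorm_smul hc]
        · exact (mul_nonpos_of_nonpos_of_nonneg hc (dualTripleNorm_nonneg x)).trans
            (dualTripleNorm_nonneg _))
    refine ⟨g, ?_, hg'⟩
    have := hg ⟨x, Submodule.mem_span_singleton_self x⟩
    rw [this]
    exact LinearPMap.mkSpanSingleton_apply ..
  obtain ⟨w, hw⟩ := exists_eq_sum_trace f
  refine ⟨w, (tripleNorm_le_iff zero_le_one).2 ⟨?_, ?_⟩, by rw [← hfx, hw]⟩
  -- The two trivial splittings, z = 0 here and y = 0 below, yield the column and the row bound.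
  · rw [one_pow]
    refine colBound_one_of_le fun u => ?_
    rw [← hw]
    refine (hf u).trans ((dualTripleNorm_le (y := u) (z := 0) (by simp)).trans ?_)
    simp [trSqrt]
  · rw [one_pow]
    refine colBound_one_of_le fun u => ?_
    have e : ∑ i, (trace (u i * (w i)ᴴᴴ)).re = f fun i => (u i)ᴴ := by
      rw [hw]
      refine Finset.sum_congr rfl fun i _ => ?_
      rw [conjTranspose_conjTranspose, ← conjTranspose_mul, trace_conjTranspose, trace_mul_comm]
      simp
    rw [e]
    refine (hf _).trans ((dualTripleNorm_le (y := 0) (z := fun i => (u i)ᴴ) (by simp)).trans ?_)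
    simp [trSqrt]

end Duality

end NCKhintchine

namespace NCKhintchine

open MeasureTheory ProbabilityTheory ComplexConjugate

/-! ### Moments of complex Gaussian variables -/

section Moments

theorem integral_stdComplexGaussian (f : ℂ → ℂ) :
    ∫ z, f z ∂stdComplexGaussian
      = ∫ z : ℂ, (Real.pi⁻¹ * Real.exp (-‖z‖ ^ 2)) • f z := by
  rw [stdComplexGaussian, integral_withDensity_eq_integral_toReal_smul (by fun_prop)
    (Filter.Eventually.of_forall fun _ => ENNReal.ofReal_lt_top)]
  refine integral_congr_ae (Filter.Eventually.of_forall fun z => ?_)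
  simp only
  rw [ENNReal.toReal_ofReal (by positivity)]

theorem integral_stdComplexGaussian_pow_mul_conj_pow_self (a : ℕ) :
    ∫ z, z ^ a * conj z ^ a ∂stdComplexGaussian = (a.factorial : ℂ) := by
  have h := Complex.integral_rpow_mul_exp_neg_rpow (p := 2) (q := 2 * a) one_le_two
    (by linarith [(Nat.cast_nonneg a : (0 : ℝ) ≤ a)])
  rw [show (2 * (a : ℝ) + 2) / 2 = a + 1 by ring, Real.Gamma_nat_eq_factorial] at h
  rw [integral_stdComplexGaussian]
  have e : ∀ z : ℂ, (Real.pi⁻¹ * Real.exp (-‖z‖ ^ 2)) • (z ^ a * conj z ^ a)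
      = ((Real.pi⁻¹ * (‖z‖ ^ (2 * a : ℝ) * Real.exp (-‖z‖ ^ (2 : ℝ))) : ℝ) : ℂ) := fun z => by
    rw [← mul_pow, Complex.mul_conj', Real.rpow_mul (norm_nonneg _), Real.rpow_two,
      Real.rpow_natCast]
    simp only [Complex.real_smul]
    push_cast
    ring
  simp_rw [e]
  rw [integral_complex_ofReal, integral_const_mul, h]
  have := Real.pi_ne_zero
  rw [show Real.pi⁻¹ * (2 * Real.pi / 2 * (a.factorial : ℝ)) = a.factorial by field_simp]
  simp

/-- The law is invariant under z ↦ iz, which multiplies the integrand by i^(a−b). For exponents at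
most 2 this factor is 1 only when a = b. -/
theorem integral_stdComplexGaussian_pow_mul_conj_pow {a b : ℕ} (ha : a ≤ 2) (hb : b ≤ 2) :
    ∫ z, z ^ a * conj z ^ b ∂stdComplexGaussian = if a = b then (a.factorial : ℂ) else 0 := by
  split_ifs with hab
  · subst hab; exact integral_stdComplexGaussian_pow_mul_conj_pow_self a
  rw [integral_stdComplexGaussian]
  set F : ℂ → ℂ := fun z => (Real.pi⁻¹ * Real.exp (-‖z‖ ^ 2)) • (z ^ a * conj z ^ b) with hF
  have h1 : ∫ z, F (rotation (Circle.exp (Real.pi / 2)) z) = ∫ z, F z :=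
    (LinearIsometryEquiv.measurePreserving (rotation (Circle.exp (Real.pi / 2)))).integral_comp
      (rotation (Circle.exp (Real.pi / 2))).toHomeomorph.measurableEmbedding F
  have h2 : ∀ z, F (rotation (Circle.exp (Real.pi / 2)) z)
      = (Complex.I ^ a * (-Complex.I) ^ b) * F z := fun z => by
    have : rotation (Circle.exp (Real.pi / 2)) z = Complex.I * z := by
      rw [rotation_apply, Circle.coe_exp]
      push_cast
      rw [Complex.exp_pi_div_two_mul_I]
    rw [this, hF]
    simp only [norm_mul, Complex.norm_I, one_mul, map_mul, Complex.conj_I, mul_pow,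
      Complex.real_smul]
    ring
  simp_rw [h2] at h1
  rw [integral_const_mul] at h1
  have h3 : Complex.I ^ a * (-Complex.I) ^ b ≠ 1 := by
    interval_cases a <;> interval_cases b <;> simp [Complex.ext_iff, pow_succ] at hab ⊢ <;>
      norm_num
  have h4 : (Complex.I ^ a * (-Complex.I) ^ b - 1) * ∫ z, F z = 0 := by
    rw [sub_mul, h1, one_mul, sub_self]
  exact (mul_eq_zero.1 h4).resolve_left (sub_ne_zero.2 h3)

/-- If integrability failed, the Bochner integral would be 0 by convention, whereas it was computed
to be 2. -/
theorem integrable_norm_pow_four_stdComplexGaussian :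
    Integrable (fun z : ℂ => ‖z‖ ^ 4) stdComplexGaussian := by
  by_contra h
  have h1 := integral_stdComplexGaussian_pow_mul_conj_pow_self 2
  have e : (fun z : ℂ => z ^ 2 * conj z ^ 2) = fun z => ((‖z‖ ^ 4 : ℝ) : ℂ) := by
    funext z
    rw [← mul_pow, Complex.mul_conj']
    push_cast
    ring
  rw [e, integral_complex_ofReal, integral_undef h] at h1
  norm_num at h1

/-- The moments of order at most four of a family of independent standard complex Gaussian
variables. -/
structure GaussianMoments {Ω : Type*} [MeasurableSpace Ω] (P : Measure Ω) {d : ℕ}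
    (γ : Fin d → Ω → ℂ) : Prop where
  aestronglyMeasurable : ∀ i, AEStronglyMeasurable (γ i) P
  integrable_pow : ∀ i, Integrable (fun ω => ‖γ i ω‖ ^ 4) P
  second : ∀ i j, ∫ ω, γ i ω * conj (γ j ω) ∂P = if i = j then 1 else 0
  fourth : ∀ i j k l, ∫ ω, conj (γ i ω) * γ j ω * (conj (γ k ω) * γ l ω) ∂P
    = (if i = j ∧ k = l then 1 else 0) + if i = l ∧ k = j then 1 else 0

variable {Ω : Type*} [MeasurableSpace Ω] {P : Measure Ω} {d : ℕ} {γ : Fin d → Ω → ℂ}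

/-- This symmetry lets every column estimate be reused for rows after taking adjoints. -/
theorem GaussianMoments.conj (h : GaussianMoments P γ) :
    GaussianMoments P (fun i ω => conj (γ i ω)) where
  aestronglyMeasurable i := Complex.continuous_conj.comp_aestronglyMeasurable
    (h.aestronglyMeasurable i)
  integrable_pow i := by simpa using h.integrable_pow i
  second i j := by
    have := h.second j i
    simp only [RingHomCompTriple.comp_apply, RingHom.id_apply]
    simp_rw [mul_comm (conj (γ i _)), this, eq_comm]
  fourth i j k l := by
    have := h.fourth j i l k
    simp only [Complex.conj_conj]
    simp_rw [mul_comm (conj (γ j _)) (γ i _), mul_comm (conj (γ l _)) (γ k _)] at this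
    rw [this]
    congr 1
    · simp only [eq_comm]
    · simp only [eq_comm, and_comm]

theorem integral_prod_pow_mul_conj_pow
    (hγ : ∀ i, HasLaw (γ i) stdComplexGaussian P) (hindep : iIndepFun γ P) {a b : Fin d → ℕ}
    (ha : ∀ m, a m ≤ 2) (hb : ∀ m, b m ≤ 2) :
    ∫ ω, ∏ m, (γ m ω ^ a m * conj (γ m ω) ^ b m) ∂P
      = ∏ m, if a m = b m then ((a m).factorial : ℂ) else 0 := by
  have hc : ∀ m, Continuous fun z : ℂ => z ^ a m * conj z ^ b m := fun m => by
    have := Complex.continuous_conj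
    fun_prop
  have := hindep.integral_fun_prod_comp (f := fun m z => z ^ a m * conj z ^ b m)
    (fun i => (hγ i).aemeasurable) (fun m => (hc m).aestronglyMeasurable)
  rw [this]
  refine Finset.prod_congr rfl fun m _ => ?_
  rw [← integral_stdComplexGaussian_pow_mul_conj_pow (ha m) (hb m)]
  exact (hγ m).integral_comp (hc m).aestronglyMeasurable

theorem prod_pow_ite_eq (f : Fin d → ℂ) (i : Fin d) :
    ∏ m, f m ^ (if m = i then 1 else 0) = f i := by
  rw [Finset.prod_eq_single i (fun m _ hm => by simp [hm]) (by simp)]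
  simp

theorem gaussianMoments (hγ : ∀ i, HasLaw (γ i) stdComplexGaussian P) (hindep : iIndepFun γ P) :
    GaussianMoments P γ where
  aestronglyMeasurable i := (hγ i).aemeasurable.aestronglyMeasurable
  integrable_pow i := by
    have h1 := integrable_norm_pow_four_stdComplexGaussian
    rw [← (hγ i).map_eq] at h1
    exact h1.comp_aemeasurable (hγ i).aemeasurable
  second i j := by
    have h := integral_prod_pow_mul_conj_pow hγ hindep (a := fun m => if m = i then 1 else 0)
      (b := fun m => if m = j then 1 else 0) (fun m => by split_ifs <;> simp)
      (fun m => by split_ifs <;> simp)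
    simp only [Finset.prod_mul_distrib, prod_pow_ite_eq] at h
    rw [h]
    split_ifs with hij
    · subst hij
      refine Finset.prod_eq_one fun m _ => ?_
      by_cases hm : m = i <;> simp [hm]
    · exact Finset.prod_eq_zero (Finset.mem_univ i) (by simp [hij])
  fourth i j k l := by
    have h := integral_prod_pow_mul_conj_pow hγ hindep
      (a := fun m => (if m = j then 1 else 0) + if m = l then 1 else 0)
      (b := fun m => (if m = i then 1 else 0) + if m = k then 1 else 0)
      (fun m => by split_ifs <;> simp) (fun m => by split_ifs <;> simp)
    simp only [pow_add, Finset.prod_mul_distrib, prod_pow_ite_eq] at h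
    have e : ∀ ω, conj (γ i ω) * γ j ω * (conj (γ k ω) * γ l ω)
      = γ j ω * γ l ω * (conj (γ i ω) * conj (γ k ω)) := fun ω => by ring
    simp_rw [e]
    rw [h]
    -- The product survives only if {j, l} and {i, k} agree as multisets. If j = l, the factor 2!
    -- matches both pairings holding at once; if j ≠ l, exactly one pairing holds and every factor
    -- is 1.
    by_cases hm : ∀ m, ((if m = j then 1 else 0) + if m = l then 1 else 0)
        = (if m = i then 1 else 0) + if m = k then 1 else 0
    · rw [Finset.prod_congr rfl fun m _ => if_pos (hm m)]
      have hi := hm i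
      have hj := hm j
      have hk := hm k
      have hl := hm l
      by_cases hjl : j = l
      · have : i = j ∧ k = j := by grind
        obtain ⟨rfl, rfl⟩ := this
        subst hjl
        rw [Finset.prod_eq_single k]
        · norm_num
        · intro m _ hmk; simp [hmk]
        · simp
      · rw [Finset.prod_eq_one]
        · grind
        · intro m _
          by_cases h1 : m = j
          · have : m ≠ l := by grind
            simp [h1, hjl]
          · split_ifs <;> simp
    · obtain ⟨m, hm⟩ := not_forall.1 hm
      rw [Finset.prod_eq_zero (Finset.mem_univ m) (if_neg hm)]
      grind

/-- Normalize the bounded function γ_j/(1 + |γ_j|²) by its pairing with γ_j, which is nonzero. For i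
≠ j, independence and the vanishing mean of γ_i kill the pairing. -/
theorem exists_bounded_biorthogonal [IsProbabilityMeasure P]
    (hγ : ∀ i, HasLaw (γ i) stdComplexGaussian P) (hindep : iIndepFun γ P) :
    ∃ (f : Fin d → Ω → ℂ) (C : ℝ), (∀ i, AEStronglyMeasurable (f i) P) ∧ (∀ i ω, ‖f i ω‖ ≤ C) ∧
      ∀ i j, ∫ ω, f j ω * conj (γ i ω) ∂P = if i = j then 1 else 0 := by
  set g : ℂ → ℂ := fun z => ((1 + ‖z‖ ^ 2 : ℝ) : ℂ)⁻¹ * z with hg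
  have hgc : Continuous g := by
    refine Continuous.mul (Continuous.inv₀ (by fun_prop) fun z => ?_) continuous_id
    exact_mod_cast (by positivity : (1 + ‖z‖ ^ 2 : ℝ) ≠ 0)
  have hgb : ∀ z, ‖g z‖ ≤ 1 := fun z => by
    rw [hg]
    simp only [norm_mul, norm_inv, Complex.norm_real]
    rw [Real.norm_of_nonneg (by positivity), inv_mul_le_iff₀ (by positivity)]
    nlinarith [sq_nonneg (‖z‖ - 1)]
  set c : ℂ := ∫ z, g z * conj z ∂stdComplexGaussian with hc
  have hcomp : ∀ i, ∫ ω, g (γ i ω) * conj (γ i ω) ∂P = c := fun i =>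
    (hγ i).integral_comp (f := fun z => g z * conj z)
      (hgc.mul Complex.continuous_conj).aestronglyMeasurable
  have hmean : ∀ i, ∫ ω, conj (γ i ω) ∂P = 0 := fun i => by
    have h1 := (hγ i).integral_comp (f := fun z => conj z)
      Complex.continuous_conj.aestronglyMeasurable
    have h2 := integral_stdComplexGaussian_pow_mul_conj_pow (a := 0) (b := 1) (by simp) (by simp)
    simp only [pow_zero, one_mul, pow_one] at h2
    rw [h2] at h1
    simpa [Function.comp_def] using h1
  have hc0 : ∀ _ : Fin d, c ≠ 0 := fun i h0 => by
    have e : ∀ z : ℂ, g z * conj z = (((1 + ‖z‖ ^ 2)⁻¹ * ‖z‖ ^ 2 : ℝ) : ℂ) := fun z => by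
      simp only [hg]
      rw [mul_assoc, Complex.mul_conj']
      push_cast
      ring
    rw [← hcomp i] at h0
    simp_rw [e] at h0
    rw [integral_complex_ofReal, Complex.ofReal_eq_zero, integral_eq_zero_iff_of_nonneg] at h0
    · have h1 := (gaussianMoments hγ hindep).second i i
      rw [integral_eq_zero_of_ae] at h1
      · simp at h1
      · filter_upwards [h0] with ω hω
        have : (0 : ℝ) < 1 + ‖γ i ω‖ ^ 2 := by positivity
        simp [this.ne'] at hω
        simp [hω]
    · intro ω; simp only [Pi.zero_apply]; positivity
    · refine Integrable.of_bound ?_ 1 (Filter.Eventually.of_forall fun ω => ?_)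
      · have hk : Continuous fun z : ℂ => (1 + ‖z‖ ^ 2)⁻¹ * ‖z‖ ^ 2 := by
          refine Continuous.mul (Continuous.inv₀ (by fun_prop) fun z => by positivity)
            (by fun_prop)
        exact hk.comp_aestronglyMeasurable (hγ i).aemeasurable.aestronglyMeasurable
      · rw [Real.norm_of_nonneg (by positivity), inv_mul_le_iff₀ (by positivity)]
        linarith
  refine ⟨fun i ω => c⁻¹ * g (γ i ω), ‖c⁻¹‖, fun i => ?_, fun i ω => ?_, fun i j => ?_⟩
  · exact (hgc.comp_aestronglyMeasurable (hγ i).aemeasurable.aestronglyMeasurable).const_mul _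
  · rw [norm_mul]
    exact mul_le_of_le_one_right (norm_nonneg _) (hgb _)
  · simp_rw [mul_assoc]
    rw [integral_const_mul]
    split_ifs with hij
    · rw [hij, hcomp, inv_mul_cancel₀ (hc0 i)]
    · have := (hindep.indepFun (Ne.symm hij)).integral_fun_comp_mul_comp (f := g)
        (g := fun z => conj z) (hγ j).aemeasurable (hγ i).aemeasurable
        hgc.aestronglyMeasurable Complex.continuous_conj.aestronglyMeasurable
      rw [this, hmean, mul_zero, mul_zero]

end Moments

end NCKhintchine

namespace NCKhintchine

open Matrix MeasureTheory ProbabilityTheory ComplexConjugate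
open scoped Matrix.Norms.L2Operator MatrixOrder ComplexOrder

/-! ### The bounded transform as a smooth truncation -/

section Resolvent

variable {n : ℕ}

/-- The bounded transform `S (1 + s S^* S)⁻¹` of a matrix. -/
noncomputable def boundedTransform (s : ℝ) (S : Matrix (Fin n) (Fin n) ℂ) :
    Matrix (Fin n) (Fin n) ℂ :=
  S * (1 + (s : ℂ) • (Sᴴ * S))⁻¹

theorem posDef_one_add_smul {s : ℝ} (hs : 0 < s) (S : Matrix (Fin n) (Fin n) ℂ) :
    (1 + (s : ℂ) • (Sᴴ * S)).PosDef :=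
  PosDef.one.add_posSemidef
    ((posSemidef_conjTranspose_mul_self S).smul (by exact_mod_cast hs.le))

theorem det_one_add_smul_ne_zero {s : ℝ} (hs : 0 < s) (S : Matrix (Fin n) (Fin n) ℂ) :
    (1 + (s : ℂ) • (Sᴴ * S)).det ≠ 0 :=
  ((isUnit_iff_isUnit_det _).1 (posDef_one_add_smul hs S).isUnit).ne_zero

/-- Polarization: |u + sS^*Su|² − |u − sS^*Su|² = 4s|Su|². -/
theorem four_mul_nsq_le (s : ℝ) (S : Matrix (Fin n) (Fin n) ℂ) (u : Fin n → ℂ) :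
    4 * s * nsq (S *ᵥ u) ≤ nsq (u + (s : ℂ) • ((Sᴴ * S) *ᵥ u)) := by
  have h := nsq_nonneg (u + (-s : ℂ) • ((Sᴴ * S) *ᵥ u))
  rw [nsq_add, dotProduct_smul, star_dotProduct_conjTranspose_mul_mulVec, nsq_smul] at h ⊢
  simp only [norm_neg, smul_eq_mul, neg_mul, Complex.neg_re, Complex.re_ofReal_mul,
    Complex.ofReal_re] at h ⊢
  linarith

theorem boundedTransform_mulVec {s : ℝ} (hs : 0 < s) (S : Matrix (Fin n) (Fin n) ℂ)
    (v : Fin n → ℂ) : ∃ u, v = u + (s : ℂ) • ((Sᴴ * S) *ᵥ u) ∧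
      boundedTransform s S *ᵥ v = S *ᵥ u := by
  refine ⟨(1 + (s : ℂ) • (Sᴴ * S))⁻¹ *ᵥ v, ?_, by rw [boundedTransform, mulVec_mulVec]⟩
  have h := mul_nonsing_inv _ (isUnit_iff_ne_zero.2 (det_one_add_smul_ne_zero hs S))
  conv_lhs => rw [← one_mulVec v, ← h, ← mulVec_mulVec, add_mulVec, one_mulVec, smul_mulVec]

theorem nsq_boundedTransform_le {s : ℝ} (hs : 0 < s) (S : Matrix (Fin n) (Fin n) ℂ)
    (v : Fin n → ℂ) : 4 * s * nsq (boundedTransform s S *ᵥ v) ≤ nsq v := by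
  obtain ⟨u, hv, hu⟩ := boundedTransform_mulVec hs S v
  rw [hu, hv]
  exact four_mul_nsq_le s S u

/-- With v = (1 + sS^*S)u the difference sends v to sS(S^*Su); the polarization bound applied to
S^*Su, in place of u, gives the constant s²/(4s). -/
theorem nsq_sub_boundedTransform_le {s : ℝ} (hs : 0 < s) (S : Matrix (Fin n) (Fin n) ℂ)
    (v : Fin n → ℂ) :
    nsq ((S - boundedTransform s S) *ᵥ v) ≤ s / 4 * nsq ((Sᴴ * S) *ᵥ v) := by
  obtain ⟨u, hv, hu⟩ := boundedTransform_mulVec hs S v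
  have h1 : (S - boundedTransform s S) *ᵥ v = (s : ℂ) • (S *ᵥ ((Sᴴ * S) *ᵥ u)) := by
    rw [sub_mulVec, hu, ← mulVec_smul, ← mulVec_sub]
    congr 1
    rw [sub_eq_iff_eq_add', ← hv]
  have h2 : (Sᴴ * S) *ᵥ v = (Sᴴ * S) *ᵥ u + (s : ℂ) • ((Sᴴ * S) *ᵥ ((Sᴴ * S) *ᵥ u)) := by
    conv_lhs => rw [hv, mulVec_add, mulVec_smul]
  have h3 := four_mul_nsq_le s S ((Sᴴ * S) *ᵥ u)
  rw [h1, h2, nsq_smul, Complex.norm_real, Real.norm_of_nonneg hs.le]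
  nlinarith

/-- From the intertwining (1 + sS^*S)S^* = S^*(1 + sSS^*). One truncation therefore serves columns
and rows simultaneously. -/
theorem boundedTransform_conjTranspose {s : ℝ} (hs : 0 < s) (S : Matrix (Fin n) (Fin n) ℂ) :
    (boundedTransform s S)ᴴ = boundedTransform s Sᴴ := by
  have h1 := isUnit_iff_ne_zero.2 (det_one_add_smul_ne_zero hs S)
  have h2 := isUnit_iff_ne_zero.2 (det_one_add_smul_ne_zero hs Sᴴ)
  have h3 : ((1 + (s : ℂ) • (Sᴴ * S))⁻¹)ᴴ = (1 + (s : ℂ) • (Sᴴ * S))⁻¹ :=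
    (posDef_one_add_smul hs S).inv.isHermitian
  rw [boundedTransform, boundedTransform, conjTranspose_mul, h3]
  have h4 : (1 + (s : ℂ) • (Sᴴ * S)) * Sᴴ = Sᴴ * (1 + (s : ℂ) • (Sᴴᴴ * Sᴴ)) := by
    rw [conjTranspose_conjTranspose, add_mul, mul_add, one_mul, mul_one, smul_mul_assoc,
      mul_smul_comm, mul_assoc]
  calc (1 + (s : ℂ) • (Sᴴ * S))⁻¹ * Sᴴ
      = (1 + (s : ℂ) • (Sᴴ * S))⁻¹ * (Sᴴ * (1 + (s : ℂ) • (Sᴴᴴ * Sᴴ)))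
          * (1 + (s : ℂ) • (Sᴴᴴ * Sᴴ))⁻¹ := by
        rw [mul_assoc, mul_assoc, mul_nonsing_inv _ h2, mul_one]
    _ = _ := by rw [← h4, ← mul_assoc, nonsing_inv_mul _ h1, one_mul]

theorem norm_boundedTransform_le {s c : ℝ} (hs : 0 < s) (hc : 0 ≤ c) (h : 4 * s * c ^ 2 = 1)
    (S : Matrix (Fin n) (Fin n) ℂ) : ‖boundedTransform s S‖ ≤ c := by
  refine (norm_le_iff_nsq hc).2 fun v => ?_
  have := mul_le_mul_of_nonneg_left (nsq_boundedTransform_le hs S v) (sq_nonneg c)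
  calc nsq (boundedTransform s S *ᵥ v) = (4 * s * c ^ 2) * nsq (boundedTransform s S *ᵥ v) := by
        rw [h, one_mul]
    _ ≤ _ := by linarith

theorem norm_apply_le_norm (A : Matrix (Fin n) (Fin n) ℂ) (k l : Fin n) : ‖A k l‖ ≤ ‖A‖ := by
  have h := (norm_le_iff_nsq (norm_nonneg A)).1 le_rfl (Pi.single l 1)
  have h1 : nsq (Pi.single l (1 : ℂ) : Fin n → ℂ) = 1 := by
    rw [nsq, Finset.sum_eq_single l (fun m _ hm => by simp [hm]) (by simp)]; simp
  rw [h1, mul_one, mulVec_single_one] at h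
  have h2 : ‖A k l‖ ^ 2 ≤ nsq (A.col l) :=
    Finset.single_le_sum (f := fun k => ‖A.col l k‖ ^ 2) (fun _ _ => by positivity)
      (Finset.mem_univ k)
  exact le_of_sq_le_sq (h2.trans h) (norm_nonneg _)

theorem continuous_boundedTransform_sum {d : ℕ} {s : ℝ} (hs : 0 < s)
    (x : Fin d → Matrix (Fin n) (Fin n) ℂ) (k l : Fin n) :
    Continuous fun z : Fin d → ℂ => boundedTransform s (∑ i, z i • x i) k l := by
  have hS : Continuous fun z : Fin d → ℂ => ∑ i, z i • x i := by fun_prop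
  have hA : Continuous fun z : Fin d → ℂ =>
      1 + (s : ℂ) • ((∑ i, z i • x i)ᴴ * (∑ i, z i • x i)) := by fun_prop
  have hI : Continuous fun z : Fin d → ℂ =>
      (1 + (s : ℂ) • ((∑ i, z i • x i)ᴴ * (∑ i, z i • x i)))⁻¹ := by
    simp only [inv_def, Ring.inverse_eq_inv']
    exact (hA.matrix_det.inv₀ fun z => det_one_add_smul_ne_zero hs _).smul hA.matrix_adjugate
  exact (hS.matrix_mul hI).matrix_elem k l

end Resolvent

/-! ### Gaussian coefficients and Bessel's inequality -/

section Bessel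

variable {Ω : Type*} [MeasurableSpace Ω] {P : Measure Ω} {d n : ℕ} {γ : Fin d → Ω → ℂ}

theorem GaussianMoments.memLp_four (h : GaussianMoments P γ) (i : Fin d) : MemLp (γ i) 4 P := by
  rw [← integrable_norm_rpow_iff (h.aestronglyMeasurable i) (by norm_num) (by norm_num)]
  have e : (4 : ENNReal).toReal = ((4 : ℕ) : ℝ) := by norm_num
  simp only [e, Real.rpow_natCast]
  exact h.integrable_pow i

/-- The matrices `x_i = (Id ⊗ φ_i)(Y)`, for a matrix valued function `Y`. -/
noncomputable def coeff (P : Measure Ω) (γ : Fin d → Ω → ℂ) (Y : Ω → Matrix (Fin n) (Fin n) ℂ)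
    (i : Fin d) : Matrix (Fin n) (Fin n) ℂ :=
  Matrix.of fun k l => ∫ ω, Y ω k l * conj (γ i ω) ∂P

theorem coeff_conjTranspose (Y : Ω → Matrix (Fin n) (Fin n) ℂ) (i : Fin d) :
    (coeff P γ Y i)ᴴ = coeff P (fun i ω => conj (γ i ω)) (fun ω => (Y ω)ᴴ) i := by
  ext k l
  simp only [coeff, conjTranspose_apply, Matrix.of_apply, RCLike.star_def]
  rw [← integral_conj]
  simp

theorem memLp_mulVec {Y : Ω → Matrix (Fin n) (Fin n) ℂ}
    (hY : ∀ k l, MemLp (fun ω => Y ω k l) 2 P) (v : Fin n → ℂ) (k : Fin n) :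
    MemLp (fun ω => (Y ω *ᵥ v) k) 2 P := by
  simp only [mulVec, dotProduct]
  exact memLp_finsetSum _ fun l _ => (hY k l).mul_const (v l)

theorem integrable_nsq_mulVec {Y : Ω → Matrix (Fin n) (Fin n) ℂ}
    (hY : ∀ k l, MemLp (fun ω => Y ω k l) 2 P) (v : Fin n → ℂ) :
    Integrable (fun ω => nsq (Y ω *ᵥ v)) P :=
  integrable_finsetSum _ fun k _ =>
    (memLp_two_iff_integrable_sq_norm (memLp_mulVec hY v k).1).1 (memLp_mulVec hY v k)

variable [IsProbabilityMeasure P]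

theorem GaussianMoments.memLp_two (h : GaussianMoments P γ) (i : Fin d) : MemLp (γ i) 2 P :=
  (h.memLp_four i).mono_exponent (by norm_num)

theorem GaussianMoments.sum_norm_sq_integral_le (h : GaussianMoments P γ) {f : Ω → ℂ}
    (hf : MemLp f 2 P) :
    ∑ i, ‖∫ ω, f ω * conj (γ i ω) ∂P‖ ^ 2 ≤ ∫ ω, ‖f ω‖ ^ 2 ∂P := by
  have key : ∀ {g g' : Ω → ℂ} (hg : MemLp g 2 P) (hg' : MemLp g' 2 P),
      inner ℂ (hg.toLp g) (hg'.toLp g') = ∫ ω, g' ω * conj (g ω) ∂P := fun hg hg' => by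
    rw [L2.inner_def]
    refine integral_congr_ae ?_
    filter_upwards [hg.coeFn_toLp, hg'.coeFn_toLp] with ω h1 h2
    rw [h1, h2, RCLike.inner_apply]
  have ho : Orthonormal ℂ fun i => (h.memLp_two i).toLp (γ i) := by
    rw [orthonormal_iff_ite]
    intro i j
    rw [key, h.second]
    simp only [eq_comm]
  have hb := ho.sum_inner_products_le (hf.toLp f) (s := Finset.univ)
  simp only [key] at hb
  refine hb.trans (le_of_eq ?_)
  have h2 : ((‖hf.toLp f‖ ^ 2 : ℝ) : ℂ) = ((∫ ω, ‖f ω‖ ^ 2 ∂P : ℝ) : ℂ) := by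
    have := inner_self_eq_norm_sq_to_K (𝕜 := ℂ) (hf.toLp f)
    rw [key] at this
    rw [← integral_complex_ofReal, Complex.ofReal_pow]
    refine this.symm.trans (integral_congr_ae (Filter.Eventually.of_forall fun ω => ?_))
    simp [Complex.mul_conj']
  exact_mod_cast h2

theorem GaussianMoments.integrable_mul_conj (h : GaussianMoments P γ) {f : Ω → ℂ}
    (hf : MemLp f 2 P) (i : Fin d) : Integrable (fun ω => f ω * conj (γ i ω)) P :=
  hf.integrable_mul (h.conj.memLp_two i)

theorem GaussianMoments.coeff_mulVec (h : GaussianMoments P γ)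
    {Y : Ω → Matrix (Fin n) (Fin n) ℂ} (hY : ∀ k l, MemLp (fun ω => Y ω k l) 2 P)
    (v : Fin n → ℂ) (i : Fin d) (k : Fin n) :
    (coeff P γ Y i *ᵥ v) k = ∫ ω, (Y ω *ᵥ v) k * conj (γ i ω) ∂P := by
  simp only [coeff, mulVec, dotProduct, Matrix.of_apply, Finset.sum_mul]
  rw [integral_finsetSum _ fun l _ => ?_]
  · refine Finset.sum_congr rfl fun l _ => ?_
    rw [← integral_mul_const]
    refine integral_congr_ae (Filter.Eventually.of_forall fun ω => ?_)
    simp only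
    ring
  · exact h.integrable_mul_conj ((hY k l).mul_const (v l)) i

theorem GaussianMoments.sum_nsq_coeff_le (h : GaussianMoments P γ)
    {Y : Ω → Matrix (Fin n) (Fin n) ℂ} (hY : ∀ k l, MemLp (fun ω => Y ω k l) 2 P)
    (v : Fin n → ℂ) :
    ∑ i, nsq (coeff P γ Y i *ᵥ v) ≤ ∫ ω, nsq (Y ω *ᵥ v) ∂P := by
  simp only [nsq]
  rw [Finset.sum_comm, integral_finsetSum _ fun k _ =>
    (memLp_two_iff_integrable_sq_norm (memLp_mulVec hY v k).1).1 (memLp_mulVec hY v k)]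
  refine Finset.sum_le_sum fun k _ => ?_
  simp only [h.coeff_mulVec hY]
  exact h.sum_norm_sq_integral_le (memLp_mulVec hY v k)

end Bessel

end NCKhintchine

namespace NCKhintchine

open Matrix MeasureTheory ProbabilityTheory ComplexConjugate
open scoped Matrix.Norms.L2Operator MatrixOrder ComplexOrder

/-! ### The fourth-moment estimate -/

section FourthMoment

variable {Ω : Type*} [MeasurableSpace Ω] {P : Measure Ω} {d n : ℕ} {γ : Fin d → Ω → ℂ}

theorem GaussianMoments.integrable_four (h : GaussianMoments P γ) (i j k l : Fin d) :
    Integrable (fun ω => conj (γ i ω) * γ j ω * (conj (γ k ω) * γ l ω)) P := by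
  have hm := fun i => h.aestronglyMeasurable i
  have hm' := fun i => h.conj.aestronglyMeasurable i
  refine Integrable.mono' ((((h.integrable_pow i).add (h.integrable_pow j)).add
    (h.integrable_pow k)).add (h.integrable_pow l)) (((hm' i).mul (hm j)).mul
      ((hm' k).mul (hm l))) (Filter.Eventually.of_forall fun ω => ?_)
  simp only [norm_mul, RCLike.norm_conj, Pi.add_apply]
  generalize ‖γ i ω‖ = a
  generalize ‖γ j ω‖ = b
  generalize ‖γ k ω‖ = c
  generalize ‖γ l ω‖ = e
  nlinarith [sq_nonneg (a * b - c * e), sq_nonneg (a ^ 2 - b ^ 2), sq_nonneg (c ^ 2 - e ^ 2),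
    sq_nonneg (a ^ 2), sq_nonneg (b ^ 2), sq_nonneg (c ^ 2), sq_nonneg (e ^ 2)]

theorem nsq_conjTranspose_mul_self_sum (x : Fin d → Matrix (Fin n) (Fin n) ℂ) (z : Fin d → ℂ)
    (v : Fin n → ℂ) :
    (nsq (((∑ i, z i • x i)ᴴ * (∑ i, z i • x i)) *ᵥ v) : ℂ)
      = ∑ i, ∑ j, ∑ k, ∑ l, conj (z i) * z j * (conj (z k) * z l)
          * (star v ⬝ᵥ (((x i)ᴴ * x j * ((x k)ᴴ * x l)) *ᵥ v)) := by
  have hA : (∑ i, z i • x i)ᴴ * (∑ i, z i • x i)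
      = ∑ i, ∑ j, (conj (z i) * z j) • ((x i)ᴴ * x j) := by
    simp only [conjTranspose_sum, conjTranspose_smul, Finset.sum_mul_sum, smul_mul_smul_comm,
      RCLike.star_def]
  rw [← star_dotProduct_conjTranspose_mul_mulVec,
    (isHermitian_conjTranspose_mul_self (∑ i, z i • x i)).eq, hA]
  simp only [Finset.sum_mul]
  simp only [Finset.mul_sum, sum_mulVec, dotProduct_sum, smul_mul_smul_comm, smul_mulVec,
    dotProduct_smul, smul_eq_mul]

theorem GaussianMoments.integrable_nsq (h : GaussianMoments P γ)
    (x : Fin d → Matrix (Fin n) (Fin n) ℂ) (v : Fin n → ℂ) :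
    Integrable (fun ω => nsq (((∑ i, γ i ω • x i)ᴴ * (∑ i, γ i ω • x i)) *ᵥ v)) P := by
  have : Integrable (fun ω =>
      (nsq (((∑ i, γ i ω • x i)ᴴ * (∑ i, γ i ω • x i)) *ᵥ v) : ℂ)) P := by
    simp only [nsq_conjTranspose_mul_self_sum]
    exact integrable_finsetSum _ fun i _ => integrable_finsetSum _ fun j _ =>
      integrable_finsetSum _ fun k _ => integrable_finsetSum _ fun l _ =>
      (h.integrable_four i j k l).mul_const _
  exact this.re

/-- The two Wick pairings contribute |∑ x_i^*x_i v|² and ∑ |x_j^*x_i v|². Each is at most s²|v|²: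
the first by the column bound, the second by the row bound followed by the column bound. -/
theorem GaussianMoments.integral_nsq_le (h : GaussianMoments P γ)
    {x : Fin d → Matrix (Fin n) (Fin n) ℂ} {s : ℝ} (hs : 0 ≤ s) (hc : ColBound x s)
    (hr : ColBound (fun i => (x i)ᴴ) s) (v : Fin n → ℂ) :
    ∫ ω, nsq (((∑ i, γ i ω • x i)ᴴ * (∑ i, γ i ω • x i)) *ᵥ v) ∂P ≤ 2 * s ^ 2 * nsq v := by
  have e : ((∫ ω, nsq (((∑ i, γ i ω • x i)ᴴ * (∑ i, γ i ω • x i)) *ᵥ v) ∂P : ℝ) : ℂ)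
      = ((nsq ((∑ i, (x i)ᴴ * x i) *ᵥ v) + ∑ i, ∑ j, nsq ((x j)ᴴ *ᵥ (x i *ᵥ v)) : ℝ) : ℂ) := by
    rw [← integral_complex_ofReal]
    simp only [nsq_conjTranspose_mul_self_sum]
    have hi := h.integrable_four
    rw [integral_finsetSum _ fun i _ => integrable_finsetSum _ fun j _ =>
      integrable_finsetSum _ fun k _ => integrable_finsetSum _ fun l _ =>
      (hi i j k l).mul_const _]
    have e1 : ∀ i, ∫ ω, ∑ j, ∑ k, ∑ l, conj (γ i ω) * γ j ω * (conj (γ k ω) * γ l ω)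
          * (star v ⬝ᵥ (((x i)ᴴ * x j * ((x k)ᴴ * x l)) *ᵥ v)) ∂P
        = ∑ k, star v ⬝ᵥ (((x i)ᴴ * x i * ((x k)ᴴ * x k)) *ᵥ v)
          + ∑ j, star v ⬝ᵥ (((x i)ᴴ * x j * ((x j)ᴴ * x i)) *ᵥ v) := fun i => by
      rw [integral_finsetSum _ fun j _ =>
        integrable_finsetSum _ fun k _ => integrable_finsetSum _ fun l _ =>
        (hi i j k l).mul_const _]
      have e2 : ∀ j, ∫ ω, ∑ k, ∑ l, conj (γ i ω) * γ j ω * (conj (γ k ω) * γ l ω)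
          * (star v ⬝ᵥ (((x i)ᴴ * x j * ((x k)ᴴ * x l)) *ᵥ v)) ∂P
          = (if i = j then ∑ k, star v ⬝ᵥ (((x i)ᴴ * x j * ((x k)ᴴ * x k)) *ᵥ v) else 0)
            + star v ⬝ᵥ (((x i)ᴴ * x j * ((x j)ᴴ * x i)) *ᵥ v) := fun j => by
        rw [integral_finsetSum _ fun k _ => integrable_finsetSum _ fun l _ =>
          (hi i j k l).mul_const _]
        simp_rw [integral_finsetSum _ fun l _ => (hi i j _ l).mul_const _, integral_mul_const,
          h.fourth, add_mul, Finset.sum_add_distrib]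
        congr 1
        · split_ifs with hij
          · simp [hij]
          · simp [hij]
        · rw [Finset.sum_eq_single j]
          · simp
          · intro k _ hk; simp [hk]
          · simp
      simp_rw [e2]
      rw [Finset.sum_add_distrib, Finset.sum_ite_eq]
      simp
    simp_rw [e1]
    rw [Finset.sum_add_distrib, Complex.ofReal_add]
    congr 1
    · rw [← star_dotProduct_conjTranspose_mul_mulVec,
        (posSemidef_sum_conjTranspose_mul_self x).isHermitian.eq]
      simp only [Finset.sum_mul_sum, sum_mulVec, dotProduct_sum]
    · push_cast
      refine Finset.sum_congr rfl fun i _ => Finset.sum_congr rfl fun j _ => ?_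
      rw [mulVec_mulVec, ← star_dotProduct_conjTranspose_mul_mulVec]
      simp
  have e' := Complex.ofReal_injective e
  rw [e']
  have h1 := (norm_le_iff_nsq hs).1 ((colBound_iff hs).1 hc) v
  have h2 : ∑ i, ∑ j, nsq ((x j)ᴴ *ᵥ (x i *ᵥ v)) ≤ s * (s * nsq v) :=
    calc ∑ i, ∑ j, nsq ((x j)ᴴ *ᵥ (x i *ᵥ v)) ≤ ∑ i, s * nsq (x i *ᵥ v) :=
          Finset.sum_le_sum fun i _ => hr (x i *ᵥ v)
      _ ≤ s * (s * nsq v) := by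
          rw [← Finset.mul_sum]
          exact mul_le_mul_of_nonneg_left (hc v) hs
  linarith

end FourthMoment

/-! ### Bounded lifts of prescribed coefficients -/

section Lifting

variable {Ω : Type*} [MeasurableSpace Ω] {P : Measure Ω} {d n : ℕ} {γ : Fin d → Ω → ℂ}

/-- A matrix valued function with measurable entries and operator norm at most `c`. -/
structure IsBoundedBy (P : Measure Ω) (Y : Ω → Matrix (Fin n) (Fin n) ℂ) (c : ℝ) : Prop where
  aestronglyMeasurable : ∀ k l, AEStronglyMeasurable (fun ω => Y ω k l) P
  norm_le : ∀ ω, ‖Y ω‖ ≤ c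

theorem IsBoundedBy.add {Y Z : Ω → Matrix (Fin n) (Fin n) ℂ} {b c : ℝ} (hY : IsBoundedBy P Y b)
    (hZ : IsBoundedBy P Z c) : IsBoundedBy P (fun ω => Y ω + Z ω) (b + c) where
  aestronglyMeasurable k l := (hY.aestronglyMeasurable k l).add (hZ.aestronglyMeasurable k l)
  norm_le ω := (norm_add_le _ _).trans (add_le_add (hY.norm_le ω) (hZ.norm_le ω))

variable [IsProbabilityMeasure P]

theorem GaussianMoments.memLp_sum (h : GaussianMoments P γ)
    (x : Fin d → Matrix (Fin n) (Fin n) ℂ) (k l : Fin n) :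
    MemLp (fun ω => (∑ i, γ i ω • x i) k l) 2 P := by
  simp only [Matrix.sum_apply, Matrix.smul_apply, smul_eq_mul]
  exact memLp_finsetSum _ fun i _ => (h.memLp_two i).mul_const _

theorem GaussianMoments.coeff_sum (h : GaussianMoments P γ)
    (x : Fin d → Matrix (Fin n) (Fin n) ℂ) (i : Fin d) :
    coeff P γ (fun ω => ∑ i, γ i ω • x i) i = x i := by
  ext k l
  simp only [coeff, Matrix.of_apply, Matrix.sum_apply, Matrix.smul_apply, smul_eq_mul,
    Finset.sum_mul]
  rw [integral_finsetSum _ fun j _ =>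
    h.integrable_mul_conj ((h.memLp_two j).mul_const (x j k l)) i]
  have e : ∀ j, ∫ ω, γ j ω * x j k l * conj (γ i ω) ∂P = if j = i then x j k l else 0 := fun j => by
    simp_rw [mul_right_comm _ (x j k l)]
    rw [integral_mul_const, h.second]
    simp
  simp [e]

theorem GaussianMoments.coeff_sub (h : GaussianMoments P γ)
    {Y Z : Ω → Matrix (Fin n) (Fin n) ℂ} (hY : ∀ k l, MemLp (fun ω => Y ω k l) 2 P)
    (hZ : ∀ k l, MemLp (fun ω => Z ω k l) 2 P) (i : Fin d) :
    coeff P γ (fun ω => Y ω - Z ω) i = coeff P γ Y i - coeff P γ Z i := by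
  ext k l
  simp only [coeff, Matrix.of_apply, Matrix.sub_apply, sub_mul]
  exact integral_sub (h.integrable_mul_conj (hY k l) i) (h.integrable_mul_conj (hZ k l) i)

theorem GaussianMoments.coeff_add (h : GaussianMoments P γ)
    {Y Z : Ω → Matrix (Fin n) (Fin n) ℂ} (hY : ∀ k l, MemLp (fun ω => Y ω k l) 2 P)
    (hZ : ∀ k l, MemLp (fun ω => Z ω k l) 2 P) (i : Fin d) :
    coeff P γ (fun ω => Y ω + Z ω) i = coeff P γ Y i + coeff P γ Z i := by
  ext k l
  simp only [coeff, Matrix.of_apply, Matrix.add_apply, add_mul]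
  exact integral_add (h.integrable_mul_conj (hY k l) i) (h.integrable_mul_conj (hZ k l) i)

theorem IsBoundedBy.memLp {Y : Ω → Matrix (Fin n) (Fin n) ℂ} {c : ℝ} (hY : IsBoundedBy P Y c)
    (p : ENNReal) (k l : Fin n) : MemLp (fun ω => Y ω k l) p P :=
  MemLp.of_bound (hY.aestronglyMeasurable k l) c
    (Filter.Eventually.of_forall fun ω => (norm_apply_le_norm _ k l).trans (hY.norm_le ω))

/-- The residues are the coefficients of the truncation error, so Bessel and the fourth moment give
(s/4)·2t⁴ = t²/4. -/
theorem GaussianMoments.colBound_sub_coeff (h : GaussianMoments P γ)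
    {x : Fin d → Matrix (Fin n) (Fin n) ℂ} {t s : ℝ} (ht : 0 < t) (hs : 0 < s)
    (hst : 2 * s * t ^ 2 = 1) (hc : ColBound x (t ^ 2)) (hr : ColBound (fun i => (x i)ᴴ) (t ^ 2))
    (hY : ∀ k l, MemLp (fun ω => boundedTransform s (∑ i, γ i ω • x i) k l) 2 P) :
    ColBound (fun i => x i - coeff P γ (fun ω => boundedTransform s (∑ i, γ i ω • x i)) i)
      ((t / 2) ^ 2) := by
  intro v
  have h1 := h.sum_nsq_coeff_le (fun k l => (h.memLp_sum x k l).sub (hY k l)) v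
    (Y := fun ω => (∑ i, γ i ω • x i) - boundedTransform s (∑ i, γ i ω • x i))
  simp only [h.coeff_sub (h.memLp_sum x) hY, h.coeff_sum] at h1
  refine h1.trans ?_
  calc ∫ ω, nsq (((∑ i, γ i ω • x i) - boundedTransform s (∑ i, γ i ω • x i)) *ᵥ v) ∂P
      ≤ ∫ ω, s / 4 * nsq (((∑ i, γ i ω • x i)ᴴ * (∑ i, γ i ω • x i)) *ᵥ v) ∂P :=
        integral_mono_of_nonneg (Filter.Eventually.of_forall fun _ => nsq_nonneg _)
          ((h.integrable_nsq x v).const_mul _)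
          (Filter.Eventually.of_forall fun ω => nsq_sub_boundedTransform_le hs _ v)
    _ ≤ s / 4 * (2 * (t ^ 2) ^ 2 * nsq v) := by
        rw [integral_const_mul]
        exact mul_le_mul_of_nonneg_left (h.integral_nsq_le (by positivity) hc hr v) (by positivity)
    _ = (2 * s * t ^ 2) * ((t / 2) ^ 2 * nsq v) := by ring
    _ = (t / 2) ^ 2 * nsq v := by rw [hst, one_mul]

theorem GaussianMoments.exists_lift_half (h : GaussianMoments P γ)
    {x : Fin d → Matrix (Fin n) (Fin n) ℂ} {t : ℝ} (ht : 0 < t) (hx : tripleNorm x ≤ t) :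
    ∃ Y, IsBoundedBy P Y (√2 * t / 2) ∧ tripleNorm (fun i => x i - coeff P γ Y i) ≤ t / 2 := by
  obtain ⟨hc, hr⟩ := (tripleNorm_le_iff ht.le).1 hx
  -- This s gives truncation norm 1/(2√s) = √2·t/2 and residue t/2.
  set s : ℝ := (2 * t ^ 2)⁻¹ with hs'
  have hs : 0 < s := by positivity
  have hst : 2 * s * t ^ 2 = 1 := by rw [hs']; field_simp
  have hY : IsBoundedBy P (fun ω => boundedTransform s (∑ i, γ i ω • x i)) (√2 * t / 2) := by
    refine ⟨fun k l => ?_, fun ω => norm_boundedTransform_le hs (by positivity) ?_ _⟩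
    · have hm : AEMeasurable (fun ω i => γ i ω) P :=
        aemeasurable_pi_iff.2 fun i => (h.aestronglyMeasurable i).aemeasurable
      exact (continuous_boundedTransform_sum hs x k l).comp_aestronglyMeasurable
        hm.aestronglyMeasurable
    · rw [div_pow, mul_pow, Real.sq_sqrt zero_le_two, ← hst]; ring
  refine ⟨_, hY, (tripleNorm_le_iff (by positivity)).2
    ⟨h.colBound_sub_coeff ht hs hst hc hr (hY.memLp 2), ?_⟩⟩
  have e : ∀ ω, (boundedTransform s (∑ i, γ i ω • x i))ᴴ
      = boundedTransform s (∑ i, conj (γ i ω) • (x i)ᴴ) := fun ω => by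
    rw [boundedTransform_conjTranspose hs]
    simp only [conjTranspose_sum, conjTranspose_smul, RCLike.star_def]
  have := h.conj.colBound_sub_coeff ht hs hst hr (by simpa using hc) (fun k l => by
    simp only [← e, conjTranspose_apply]
    exact (hY.memLp 2 l k).star)
  simp only [← e] at this
  simpa only [conjTranspose_sub, coeff_conjTranspose] using this

/-- Truncate, then lift the residue with t/2 in place of t. The norms add up geometrically, so the
bound √2·t does not depend on m. -/
theorem GaussianMoments.exists_lift_approx (h : GaussianMoments P γ) (m : ℕ)
    {x : Fin d → Matrix (Fin n) (Fin n) ℂ} {t : ℝ} (ht : 0 < t) (hx : tripleNorm x ≤ t) :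
    ∃ Y, IsBoundedBy P Y (√2 * t) ∧ tripleNorm (fun i => x i - coeff P γ Y i) ≤ t / 2 ^ m := by
  induction m generalizing x t with
  | zero =>
    refine ⟨fun _ => 0, ⟨fun _ _ => aestronglyMeasurable_const, fun _ => ?_⟩, ?_⟩
    · rw [norm_zero]; positivity
    · have : ∀ i, coeff P γ (fun _ => (0 : Matrix (Fin n) (Fin n) ℂ)) i = 0 := fun i => by
        ext; simp [coeff]
      simpa [this] using hx
  | succ m ih =>
    obtain ⟨Y, hY, hYx⟩ := h.exists_lift_half ht hx
    obtain ⟨Z, hZ, hZx⟩ := ih (half_pos ht) hYx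
    refine ⟨fun ω => Y ω + Z ω, ?_, ?_⟩
    · have := hY.add hZ
      rwa [show √2 * t / 2 + √2 * (t / 2) = √2 * t by ring] at this
    · simp only [h.coeff_add (hY.memLp 2) (hZ.memLp 2), ← sub_sub]
      rwa [pow_succ', ← div_div]

theorem norm_le_tripleNorm (x : Fin d → Matrix (Fin n) (Fin n) ℂ) (i : Fin d) :
    ‖x i‖ ≤ tripleNorm x := by
  refine (norm_le_iff_nsq (tripleNorm_nonneg x)).2 fun v => ?_
  refine le_trans ?_ (((tripleNorm_le_iff (tripleNorm_nonneg x)).1 le_rfl).1 v)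
  exact Finset.single_le_sum (f := fun i => nsq (x i *ᵥ v)) (fun _ _ => nsq_nonneg _)
    (Finset.mem_univ i)

theorem GaussianMoments.exists_lift (h : GaussianMoments P γ)
    (hf : ∃ (f : Fin d → Ω → ℂ) (C : ℝ), (∀ i, AEStronglyMeasurable (f i) P) ∧
      (∀ i ω, ‖f i ω‖ ≤ C) ∧ ∀ i j, ∫ ω, f j ω * conj (γ i ω) ∂P = if i = j then 1 else 0)
    {x : Fin d → Matrix (Fin n) (Fin n) ℂ} {t ε : ℝ} (ht : 0 < t) (hε : 0 < ε)
    (hx : tripleNorm x ≤ t) :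
    ∃ Y, IsBoundedBy P Y (√2 * t + ε) ∧ ∀ i, coeff P γ Y i = x i := by
  obtain ⟨f, C, hfm, hfC, hfγ⟩ := hf
  have lift : ∀ r : Fin d → Matrix (Fin n) (Fin n) ℂ,
      IsBoundedBy P (fun ω => ∑ j, f j ω • r j) (d * |C| * tripleNorm r) ∧
      ∀ i, coeff P γ (fun ω => ∑ j, f j ω • r j) i = r i := fun r => by
    refine ⟨⟨fun k l => ?_, fun ω => ?_⟩, fun i => ?_⟩
    · simp only [Matrix.sum_apply, Matrix.smul_apply, smul_eq_mul]
      exact Finset.aestronglyMeasurable_fun_sum _ fun j _ => (hfm j).mul_const _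
    · calc ‖∑ j, f j ω • r j‖ ≤ ∑ j : Fin d, |C| * tripleNorm r :=
            norm_sum_le_of_le _ fun j _ => by
              rw [norm_smul]
              exact mul_le_mul ((hfC j ω).trans (le_abs_self C)) (norm_le_tripleNorm r j)
                (norm_nonneg _) (abs_nonneg C)
        _ = d * |C| * tripleNorm r := by simp [mul_assoc]
    · ext k l
      simp only [coeff, Matrix.of_apply, Matrix.sum_apply, Matrix.smul_apply, smul_eq_mul,
        Finset.sum_mul]
      have hi : ∀ j, MemLp (f j) 2 P := fun j =>
        MemLp.of_bound (hfm j) C (Filter.Eventually.of_forall (hfC j))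
      rw [integral_finsetSum _ fun j _ => h.integrable_mul_conj ((hi j).mul_const (r j k l)) i]
      simp_rw [mul_right_comm _ (r _ k l), integral_mul_const, hfγ]
      simp
  -- Enough rounds that the residue, lifted crudely by the bounded biorthogonal system at cost d|C|
  -- times its norm, adds at most ε.
  obtain ⟨m, hm⟩ := pow_unbounded_of_one_lt (d * |C| * t / ε) one_lt_two
  obtain ⟨Y, hY, hYx⟩ := h.exists_lift_approx m ht hx
  obtain ⟨hZ, hZx⟩ := lift fun i => x i - coeff P γ Y i
  have hb := hY.add hZ
  refine ⟨_, ⟨hb.aestronglyMeasurable, fun ω => (hb.norm_le ω).trans ?_⟩, fun i => ?_⟩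
  · gcongr
    refine (mul_le_mul_of_nonneg_left hYx (by positivity)).trans ?_
    rw [div_lt_iff₀ hε] at hm
    rw [← mul_div_assoc, div_le_iff₀ (by positivity)]
    linarith
  · rw [h.coeff_add (hY.memLp 2) (hZ.memLp 2), hZx, add_sub_cancel]

end Lifting

end NCKhintchine

namespace NCKhintchine

open Matrix MeasureTheory ProbabilityTheory ComplexConjugate
open scoped Matrix.Norms.L2Operator MatrixOrder ComplexOrder

/-! ### Continuity of the trace norm -/

section TraceNorm

variable {d n : ℕ}

theorem traceNorm_le_sum_norm (x : Matrix (Fin n) (Fin n) ℂ) :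
    traceNorm x ≤ ∑ k, ∑ l, ‖x k l‖ := by
  refine le_of_forall_pos_mul_add (c := n) (by positivity) fun ε hε => ?_
  obtain ⟨w, hw, h⟩ := exists_traceNorm_sub_le x hε
  refine h.trans (add_le_add ?_ le_rfl)
  rw [trace_mul_conjTranspose_eq_sum]
  refine (Complex.re_le_norm _).trans ?_
  refine norm_sum_le_of_le _ fun k _ => norm_sum_le_of_le _ fun l _ => ?_
  rw [norm_mul, norm_star]
  exact mul_le_of_le_one_right (norm_nonneg _) ((norm_apply_le_norm w k l).trans hw)

theorem abs_traceNorm_sub_le (x y : Matrix (Fin n) (Fin n) ℂ) :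
    |traceNorm x - traceNorm y| ≤ ∑ k, ∑ l, ‖(x - y) k l‖ := by
  have h1 := traceNorm_add_le (x - y) y
  have h2 := traceNorm_add_le (y - x) x
  have h3 := traceNorm_le_sum_norm (x - y)
  have h4 := traceNorm_le_sum_norm (y - x)
  have h5 : ∑ k, ∑ l, ‖(y - x) k l‖ = ∑ k, ∑ l, ‖(x - y) k l‖ := by
    simp only [Matrix.sub_apply, norm_sub_rev]
  rw [sub_add_cancel] at h1 h2
  rw [abs_le]
  constructor <;> linarith

theorem continuous_traceNorm_sum (x : Fin d → Matrix (Fin n) (Fin n) ℂ) :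
    Continuous fun z : Fin d → ℂ => traceNorm (∑ i, z i • x i) := by
  refine continuous_iff_continuousAt.2 fun z₀ => ?_
  rw [ContinuousAt, tendsto_iff_dist_tendsto_zero]
  refine squeeze_zero (fun _ => dist_nonneg) (fun z => abs_traceNorm_sub_le _ _) ?_
  have hc : Continuous fun z : Fin d → ℂ =>
      ∑ k, ∑ l, ‖((∑ i, z i • x i) - ∑ i, z₀ i • x i) k l‖ := by
    simp only [Matrix.sub_apply, Matrix.sum_apply, Matrix.smul_apply, smul_eq_mul]
    fun_prop
  have := hc.tendsto z₀
  simpa using this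

end TraceNorm

/-! ### The Khintchine inequalities in trace norm -/

section Integrals

variable {Ω : Type*} [MeasurableSpace Ω] {P : Measure Ω} [IsProbabilityMeasure P] {d n : ℕ}
  {γ : Fin d → Ω → ℂ}

theorem GaussianMoments.integrable_traceNorm (h : GaussianMoments P γ)
    (x : Fin d → Matrix (Fin n) (Fin n) ℂ) :
    Integrable (fun ω => traceNorm (∑ i, γ i ω • x i)) P := by
  have hm : AEMeasurable (fun ω i => γ i ω) P :=
    aemeasurable_pi_iff.2 fun i => (h.aestronglyMeasurable i).aemeasurable
  refine Integrable.mono' (g := fun ω => ∑ k, ∑ l, ‖(∑ i, γ i ω • x i) k l‖)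
    (integrable_finsetSum _ fun k _ => integrable_finsetSum _ fun l _ =>
      ((h.memLp_sum x k l).integrable one_le_two).norm)
    ((continuous_traceNorm_sum x).comp_aestronglyMeasurable hm.aestronglyMeasurable)
    (Filter.Eventually.of_forall fun ω => ?_)
  rw [Real.norm_of_nonneg (show 0 ≤ traceNorm _ from trSqrt_nonneg _)]
  exact traceNorm_le_sum_norm _

theorem GaussianMoments.integral_trace_mul (h : GaussianMoments P γ)
    (y : Fin d → Matrix (Fin n) (Fin n) ℂ) (B : Matrix (Fin n) (Fin n) ℂ) :
    Integrable (fun ω => trace ((∑ i, γ i ω • y i)ᴴ * (∑ i, γ i ω • y i) * B)) P ∧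
    ∫ ω, trace ((∑ i, γ i ω • y i)ᴴ * (∑ i, γ i ω • y i) * B) ∂P
      = trace ((∑ i, (y i)ᴴ * y i) * B) := by
  have e : ∀ ω, trace ((∑ i, γ i ω • y i)ᴴ * (∑ i, γ i ω • y i) * B)
      = ∑ i, ∑ j, γ j ω * conj (γ i ω) * trace ((y i)ᴴ * y j * B) := fun ω => by
    rw [conjTranspose_sum, Finset.sum_mul_sum]
    simp only [conjTranspose_smul, Finset.sum_mul, trace_sum, smul_mul, Matrix.mul_smul, trace_smul,
      smul_eq_mul, RCLike.star_def]
    exact Finset.sum_congr rfl fun i _ => Finset.sum_congr rfl fun j _ => by ring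
  have hi : ∀ i j, Integrable (fun ω => γ j ω * conj (γ i ω) * trace ((y i)ᴴ * y j * B)) P :=
    fun i j => (h.integrable_mul_conj (h.memLp_two j) i).mul_const _
  simp_rw [e]
  refine ⟨integrable_finsetSum _ fun i _ => integrable_finsetSum _ fun j _ => hi i j, ?_⟩
  rw [integral_finsetSum _ fun i _ => integrable_finsetSum _ fun j _ => hi i j]
  simp_rw [integral_finsetSum _ fun j _ => hi _ j, integral_mul_const, h.second]
  simp [Finset.sum_mul]

/-- Jensen's inequality: apply the variational bound pointwise with one constant weight D, adapted
to E(S^*S) = ∑ y_i^*y_i, and integrate. -/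
theorem GaussianMoments.integral_traceNorm_le_trSqrt (h : GaussianMoments P γ)
    (y : Fin d → Matrix (Fin n) (Fin n) ℂ) :
    ∫ ω, traceNorm (∑ i, γ i ω • y i) ∂P ≤ trSqrt (∑ i, (y i)ᴴ * y i) := by
  refine le_of_forall_pos_mul_add (c := n / 2) (by positivity) fun ε hε => ?_
  have hT := posSemidef_sum_conjTranspose_mul_self y
  have hD := posDef_sqrt_add (∑ i, (y i)ᴴ * y i) hε
  have h1 := trace_mul_inv_sqrt_add_le hT hε
  have h2 := trace_sqrt_add (∑ i, (y i)ᴴ * y i) ε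
  set D := CFC.sqrt (∑ i, (y i)ᴴ * y i) + (ε : ℂ) • (1 : Matrix (Fin n) (Fin n) ℂ)
  obtain ⟨hi, hI⟩ := h.integral_trace_mul y D⁻¹
  have hi' : Integrable (fun ω =>
      (trace ((∑ i, γ i ω • y i)ᴴ * (∑ i, γ i ω • y i) * D⁻¹)).re) P := hi.re
  have h3 : ∫ ω, (trace ((∑ i, γ i ω • y i)ᴴ * (∑ i, γ i ω • y i) * D⁻¹)).re ∂P
      = (trace ((∑ i, (y i)ᴴ * y i) * D⁻¹)).re := by
    rw [← hI]; exact integral_re hi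
  have h4 : ∫ ω, 2 * traceNorm (∑ i, γ i ω • y i) ∂P
      ≤ ∫ ω, ((trace ((∑ i, γ i ω • y i)ᴴ * (∑ i, γ i ω • y i) * D⁻¹)).re + (trace D).re) ∂P :=
    integral_mono ((h.integrable_traceNorm y).const_mul 2) (hi'.add (integrable_const _))
      fun ω => two_mul_trSqrt_le (posSemidef_conjTranspose_mul_self _) hD
  rw [integral_const_mul, integral_add hi' (integrable_const _), h3] at h4
  simp only [integral_const, probReal_univ, one_smul] at h4
  linarith

theorem GaussianMoments.integral_traceNorm_le (h : GaussianMoments P γ)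
    (x : Fin d → Matrix (Fin n) (Fin n) ℂ) :
    ∫ ω, traceNorm (∑ i, γ i ω • x i) ∂P ≤ dualTripleNorm x := by
  refine le_dualTripleNorm fun y z hyz => ?_
  have h1 := h.integral_traceNorm_le_trSqrt y
  -- The row part is a column estimate for the adjoint family, the trace norm being invariant under
  -- adjoints.
  have h2 := h.conj.integral_traceNorm_le_trSqrt fun i => (z i)ᴴ
  have e : ∀ ω, traceNorm (∑ i, conj (γ i ω) • (z i)ᴴ) = traceNorm (∑ i, γ i ω • z i) := fun ω => by
    rw [← traceNorm_conjTranspose]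
    simp [conjTranspose_sum, conjTranspose_smul]
  simp only [e, conjTranspose_conjTranspose] at h2
  refine le_trans ?_ (add_le_add h1 h2)
  rw [← integral_add (h.integrable_traceNorm y) (h.integrable_traceNorm z)]
  refine integral_mono (h.integrable_traceNorm x)
    ((h.integrable_traceNorm y).add (h.integrable_traceNorm z)) fun ω => ?_
  simp only [hyz, smul_add, Finset.sum_add_distrib]
  exact traceNorm_add_le _ _

theorem GaussianMoments.integral_trace_mul_conjTranspose (h : GaussianMoments P γ)
    (x : Fin d → Matrix (Fin n) (Fin n) ℂ) {Y : Ω → Matrix (Fin n) (Fin n) ℂ}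
    (hY : ∀ k l, MemLp (fun ω => Y ω k l) 2 P) :
    Integrable (fun ω => trace ((∑ i, γ i ω • x i) * (Y ω)ᴴ)) P ∧
    ∫ ω, trace ((∑ i, γ i ω • x i) * (Y ω)ᴴ) ∂P = ∑ i, trace (x i * (coeff P γ Y i)ᴴ) := by
  have e : ∀ ω, trace ((∑ i, γ i ω • x i) * (Y ω)ᴴ)
      = ∑ i, ∑ k, ∑ l, x i k l * conj (Y ω k l * conj (γ i ω)) := fun ω => by
    simp only [Finset.sum_mul, trace_sum, trace_mul_conjTranspose_eq_sum]
    refine Finset.sum_congr rfl fun i _ => Finset.sum_congr rfl fun k _ =>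
      Finset.sum_congr rfl fun l _ => ?_
    simp only [Matrix.smul_apply, smul_eq_mul, map_mul, Complex.conj_conj, RCLike.star_def]
    ring
  have hi : ∀ i k l, Integrable (fun ω => x i k l * conj (Y ω k l * conj (γ i ω))) P :=
    fun i k l => (Complex.conjCLE.toContinuousLinearMap.integrable_comp
      (h.integrable_mul_conj (hY k l) i)).const_mul _
  simp_rw [e]
  refine ⟨integrable_finsetSum _ fun i _ => integrable_finsetSum _ fun k _ =>
    integrable_finsetSum _ fun l _ => hi i k l, ?_⟩
  rw [integral_finsetSum _ fun i _ => integrable_finsetSum _ fun k _ =>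
    integrable_finsetSum _ fun l _ => hi i k l]
  refine Finset.sum_congr rfl fun i _ => ?_
  rw [integral_finsetSum _ fun k _ => integrable_finsetSum _ fun l _ => hi i k l,
    trace_mul_conjTranspose_eq_sum]
  refine Finset.sum_congr rfl fun k _ => ?_
  rw [integral_finsetSum _ fun l _ => hi i k l]
  refine Finset.sum_congr rfl fun l _ => ?_
  rw [integral_const_mul, integral_conj, coeff, Matrix.of_apply, RCLike.star_def]

theorem GaussianMoments.dualTripleNorm_le (h : GaussianMoments P γ)
    (hf : ∃ (f : Fin d → Ω → ℂ) (C : ℝ), (∀ i, AEStronglyMeasurable (f i) P) ∧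
      (∀ i ω, ‖f i ω‖ ≤ C) ∧ ∀ i j, ∫ ω, f j ω * conj (γ i ω) ∂P = if i = j then 1 else 0)
    (x : Fin d → Matrix (Fin n) (Fin n) ℂ) :
    dualTripleNorm x ≤ √2 * ∫ ω, traceNorm (∑ i, γ i ω • x i) ∂P := by
  -- The lift has norm at most √2 + ε, so the slack is ε times the integral itself.
  refine le_of_forall_pos_mul_add (c := ∫ ω, traceNorm (∑ i, γ i ω • x i) ∂P)
    (integral_nonneg fun ω => trSqrt_nonneg _) fun ε hε => ?_
  obtain ⟨w, hw, hwx⟩ := exists_dualTripleNorm_eq x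
  obtain ⟨Y, hY, hYw⟩ := h.exists_lift hf one_pos hε hw
  obtain ⟨hi, hI⟩ := h.integral_trace_mul_conjTranspose x (hY.memLp 2)
  have e : dualTripleNorm x = ∫ ω, (trace ((∑ i, γ i ω • x i) * (Y ω)ᴴ)).re ∂P := by
    rw [hwx, ← Complex.re_sum]
    simp only [hYw] at hI
    rw [← hI]
    exact (integral_re hi).symm
  rw [e, ← add_mul, ← integral_const_mul]
  refine integral_mono hi.re ((h.integrable_traceNorm x).const_mul _) fun ω => ?_
  refine trace_mul_le_mul_traceNorm (by positivity) ?_ _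
  simpa using hY.norm_le ω

end Integrals

/-! ### The quotient norm of L^∞ modulo the kernel -/

section Quotient

variable {Ω : Type*} [MeasurableSpace Ω] {P : Measure Ω} {d n : ℕ} {γ : Fin d → Ω → ℂ}

theorem norm_le_sum_norm (A : Matrix (Fin n) (Fin n) ℂ) :
    ‖A‖ ≤ ∑ k, ∑ l, ‖A k l‖ * ‖single k l (1 : ℂ)‖ := by
  conv_lhs => rw [matrix_eq_sum_single A]
  refine norm_sum_le_of_le _ fun k _ => norm_sum_le_of_le _ fun l _ => ?_
  rw [← norm_smul, smul_single, smul_eq_mul, mul_one]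

theorem ae_norm_le_linftyMatrixNorm (X : Matrix (Fin n) (Fin n) (Lp ℂ ⊤ P)) :
    ∀ᵐ ω ∂P, ‖(Matrix.of fun k l => X k l ω : Matrix (Fin n) (Fin n) ℂ)‖
      ≤ linftyMatrixNorm X := by
  -- Finiteness must be known first, since `toReal` would send an infinite essential supremum to 0.
  have hfin : eLpNorm (fun ω => (Matrix.of fun k l => X k l ω : Matrix (Fin n) (Fin n) ℂ)) ⊤ P
      < ⊤ := by
    rw [eLpNorm_exponent_top]
    have hb : ∀ᵐ ω ∂P, ∀ k l, ‖X k l ω‖ ≤ (eLpNorm (X k l) ⊤ P).toReal := by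
      refine ae_all_iff.2 fun k => ae_all_iff.2 fun l => ?_
      have hl := (Lp.memLp (X k l)).2
      rw [eLpNorm_exponent_top] at hl ⊢
      filter_upwards [ae_le_eLpNormEssSup (f := X k l) (μ := P)] with ω hω
      simpa using ENNReal.toReal_mono hl.ne hω
    refine eLpNormEssSup_lt_top_of_ae_bound
      (C := ∑ k, ∑ l, (eLpNorm (X k l) ⊤ P).toReal * ‖single k l (1 : ℂ)‖) ?_
    filter_upwards [hb] with ω hω
    refine (norm_le_sum_norm _).trans ?_
    exact Finset.sum_le_sum fun k _ => Finset.sum_le_sum fun l _ =>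
      mul_le_mul_of_nonneg_right (hω k l) (norm_nonneg _)
  rw [linftyMatrixNorm]
  rw [eLpNorm_exponent_top] at hfin ⊢
  filter_upwards [ae_le_eLpNormEssSup (μ := P)
    (f := fun ω => (Matrix.of fun k l => X k l ω : Matrix (Fin n) (Fin n) ℂ))] with ω hω
  simpa using ENNReal.toReal_mono hfin.ne hω

variable [IsProbabilityMeasure P]

theorem GaussianMoments.colBound_coeff (h : GaussianMoments P γ)
    {Y : Ω → Matrix (Fin n) (Fin n) ℂ} (hY : ∀ k l, MemLp (fun ω => Y ω k l) 2 P) {c : ℝ}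
    (hc : 0 ≤ c) (hYc : ∀ᵐ ω ∂P, ‖Y ω‖ ≤ c) : ColBound (coeff P γ Y) (c ^ 2) := by
  intro v
  refine (h.sum_nsq_coeff_le hY v).trans ?_
  calc ∫ ω, nsq (Y ω *ᵥ v) ∂P ≤ ∫ _, c ^ 2 * nsq v ∂P := by
        refine integral_mono_ae (integrable_nsq_mulVec hY v) (integrable_const _) ?_
        filter_upwards [hYc] with ω hω using (norm_le_iff_nsq hc).1 hω v
    _ = c ^ 2 * nsq v := by simp

theorem GaussianMoments.tripleNorm_coeff_le (h : GaussianMoments P γ)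
    {Y : Ω → Matrix (Fin n) (Fin n) ℂ} (hY : ∀ k l, MemLp (fun ω => Y ω k l) 2 P) {c : ℝ}
    (hc : 0 ≤ c) (hYc : ∀ᵐ ω ∂P, ‖Y ω‖ ≤ c) : tripleNorm (coeff P γ Y) ≤ c := by
  refine (tripleNorm_le_iff hc).2 ⟨h.colBound_coeff hY hc hYc, ?_⟩
  simp only [coeff_conjTranspose]
  refine h.conj.colBound_coeff (fun k l => ?_) hc ?_
  · simp only [conjTranspose_apply]
    exact (hY l k).star
  · filter_upwards [hYc] with ω hω
    rwa [l2_opNorm_conjTranspose]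

theorem GaussianMoments.tripleNorm_le_quotientMatrixNorm (h : GaussianMoments P γ)
    (hi : ∀ i, Integrable (γ i) P) (X : Matrix (Fin n) (Fin n) (Lp ℂ ⊤ P)) :
    tripleNorm (fun i => X.map fun f => pairingMap hi f i)
      ≤ quotientMatrixNorm (LinearMap.ker (pairingMap hi))
        (X.map (LinearMap.ker (pairingMap hi)).mkQ) := by
  refine le_csInf ⟨_, X, rfl, rfl⟩ ?_
  rintro r ⟨W, hW, rfl⟩
  -- Lifts of the same class differ by entries in the kernel, hence have the same coefficients.
  have e : (fun i => X.map fun f => pairingMap hi f i)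
      = coeff P γ fun ω => Matrix.of fun k l => W k l ω := by
    funext i
    ext k l
    have h1 : (LinearMap.ker (pairingMap hi)).mkQ (W k l)
        = (LinearMap.ker (pairingMap hi)).mkQ (X k l) := congrFun (congrFun hW k) l
    rw [Submodule.mkQ_apply, Submodule.mkQ_apply, Submodule.Quotient.eq, LinearMap.mem_ker,
      map_sub, sub_eq_zero] at h1
    rw [Matrix.map_apply, ← h1]
    rfl
  rw [e]
  exact h.tripleNorm_coeff_le (fun k l => (Lp.memLp (W k l)).mono_exponent le_top)
    ENNReal.toReal_nonneg (ae_norm_le_linftyMatrixNorm W)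

theorem GaussianMoments.quotientMatrixNorm_le (h : GaussianMoments P γ)
    (hf : ∃ (f : Fin d → Ω → ℂ) (C : ℝ), (∀ i, AEStronglyMeasurable (f i) P) ∧
      (∀ i ω, ‖f i ω‖ ≤ C) ∧ ∀ i j, ∫ ω, f j ω * conj (γ i ω) ∂P = if i = j then 1 else 0)
    (hi : ∀ i, Integrable (γ i) P) (X : Matrix (Fin n) (Fin n) (Lp ℂ ⊤ P)) :
    quotientMatrixNorm (LinearMap.ker (pairingMap hi))
        (X.map (LinearMap.ker (pairingMap hi)).mkQ)
      ≤ √2 * tripleNorm (fun i => X.map fun f => pairingMap hi f i) := by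
  -- One ε makes the level `tripleNorm x + ε` strictly positive and contributes √2·ε; the other is
  -- the slack in the lift.
  refine le_of_forall_pos_mul_add (c := √2 + 1) (by positivity) fun ε hε => ?_
  set x : Fin d → Matrix (Fin n) (Fin n) ℂ := fun i => X.map fun f => pairingMap hi f i with hx
  have ht : 0 < tripleNorm x + ε := by linarith [tripleNorm_nonneg x]
  obtain ⟨Y, hY, hYx⟩ := h.exists_lift hf ht hε (le_add_of_nonneg_right hε.le)
  set W : Matrix (Fin n) (Fin n) (Lp ℂ ⊤ P) := Matrix.of fun k l => (hY.memLp ⊤ k l).toLp _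
    with hWdef
  have hW : ∀ᵐ ω ∂P, ∀ k l, W k l ω = Y ω k l :=
    ae_all_iff.2 fun k => ae_all_iff.2 fun l => (hY.memLp ⊤ k l).coeFn_toLp
  have hc : 0 ≤ √2 * (tripleNorm x + ε) + ε := by positivity
  have hle : linftyMatrixNorm W ≤ √2 * (tripleNorm x + ε) + ε := by
    rw [linftyMatrixNorm, eLpNorm_exponent_top]
    refine ENNReal.toReal_le_of_le_ofReal hc (eLpNormEssSup_le_of_ae_bound ?_)
    filter_upwards [hW] with ω hω
    have : (Matrix.of fun k l => W k l ω : Matrix (Fin n) (Fin n) ℂ) = Y ω := by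
      ext k l; exact hω k l
    rw [this]
    exact hY.norm_le ω
  have hq : W.map (LinearMap.ker (pairingMap hi)).mkQ
      = X.map (LinearMap.ker (pairingMap hi)).mkQ := by
    ext k l
    rw [Matrix.map_apply, Matrix.map_apply, Submodule.mkQ_apply, Submodule.mkQ_apply,
      Submodule.Quotient.eq, LinearMap.mem_ker, map_sub, sub_eq_zero]
    funext i
    have h1 : pairingMap hi (X k l) i = coeff P γ Y i k l := by rw [hYx]; rfl
    rw [h1]
    refine integral_congr_ae ?_
    filter_upwards [hW] with ω hω
    rw [hω]
  refine le_trans (csInf_le ⟨0, ?_⟩ ⟨W, hq, rfl⟩) (hle.trans (le_of_eq (by ring)))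
  rintro r ⟨Z, -, rfl⟩
  exact ENNReal.toReal_nonneg

end Quotient

end NCKhintchine

theorem mainTheorem1 {Ω : Type*} [MeasurableSpace Ω] (P : MeasureTheory.Measure Ω)
    [MeasureTheory.IsProbabilityMeasure P] (d : ℕ) (hd : 0 < d) (γ : Fin d → Ω → ℂ)
    (hγ : ∀ i, ProbabilityTheory.HasLaw (γ i) NCKhintchine.stdComplexGaussian P)
    (hindep : ProbabilityTheory.iIndepFun γ P) :
    (∀ n : ℕ, 0 < n → ∀ x : Fin d → Matrix (Fin n) (Fin n) ℂ,
      MeasureTheory.Integrable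
          (fun ω => NCKhintchine.traceNorm (∑ i, γ i ω • x i)) P ∧
        1 / Real.sqrt 2 * NCKhintchine.dualTripleNorm x
          ≤ ∫ ω, NCKhintchine.traceNorm (∑ i, γ i ω • x i) ∂P ∧
        ∫ ω, NCKhintchine.traceNorm (∑ i, γ i ω • x i) ∂P
          ≤ NCKhintchine.dualTripleNorm x) ∧
    (∀ E : MeasureTheory.Lp ℂ ⊤ P →ₗ[ℂ] (Fin d → ℂ),
      E = NCKhintchine.pairingMap (fun i => NCKhintchine.integrable_of_hasLaw (hγ i)) →
      ∀ n : ℕ, 0 < n → ∀ X : Matrix (Fin n) (Fin n) (MeasureTheory.Lp ℂ ⊤ P),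
        ∀ x : Fin d → Matrix (Fin n) (Fin n) ℂ, (∀ i, x i = X.map fun f => E f i) →
          NCKhintchine.tripleNorm x
            ≤ NCKhintchine.quotientMatrixNorm (LinearMap.ker E)
                (X.map (LinearMap.ker E).mkQ) ∧
          NCKhintchine.quotientMatrixNorm (LinearMap.ker E) (X.map (LinearMap.ker E).mkQ)
            ≤ Real.sqrt 2 * NCKhintchine.tripleNorm x) := by
  have h := NCKhintchine.gaussianMoments hγ hindep
  have hf := NCKhintchine.exists_bounded_biorthogonal hγ hindep
  refine ⟨fun n _ x => ⟨h.integrable_traceNorm x, ?_, h.integral_traceNorm_le x⟩, ?_⟩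
  · rw [one_div, inv_mul_le_iff₀ (by positivity)]
    exact h.dualTripleNorm_le hf x
  · rintro E rfl n _ X x hx
    obtain rfl := funext hx
    exact ⟨h.tripleNorm_le_quotientMatrixNorm _ X, h.quotientMatrixNorm_le hf _ X⟩
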